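/- Let $n\ge 3$ be odd, let $a_1,\dots,a_n>0$, $A=\operatorname{diag}(a_1,\dots,a_n)$, and let $E=\{x\in\mathbb R^n:\sum_{i=1}^n x_i^2/a_i^2<1\}$ be the solid ellipsoid with semi-principal axes $a_i$. Write $\omega_k$ for the total surface measure of the unit sphere $S^k\subset\mathbb R^{k+1}$ and set $$c_n:=(-1)^{(n-1)/2}\,\omega_{n-2}\,(n-2)!\,2^{3-n}.$$ For a smooth function $f:\mathbb R^n\to\mathbb R$ let $$(\mathcal Mf)(z,r)=\frac1{\omega_{n-1}}\int_{S^{n-1}}f(z+r\omega)\,d\omega,\qquad z\in\mathbb R^n,\ r>0,$$ denote its spherical means, where $d\omega$ is the standard surface measure; let $\mathcal D_r=\frac1{2r}\frac{\partial}{\partial r}$, let $r^k$ also denote the operator of multiplication by $r^k$, and let $\Delta_{Ax}=\sum_{i=1}^n a_i^{-2}\,\partial^2/\partial x_i^2$. Then for every $f\in C^\infty(\mathbb R^n)$ with support contained in $\bar E$ and every $x\in E$, $$f(x)=\frac{\det A}{c_n}\,\Delta_{Ax}\int_{S^{n-1}}\bigl(\mathcal D_r^{\,n-3}\,r^{\,n-2}\,\mathcal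 Mf\bigr)(A\sigma,|x-A\sigma|)\,d\sigma .$$ All objects in the formula are well defined in the classical sense: $r\mapsto(\mathcal Mf)(z,r)$ is smooth on $(0,\infty)$ for every $z \in \mathbb R^n$, the integrand is integrable over $S^{n-1}$ for every $x\in E$, and the integral is a twice continuously differentiable function of $x\in E$. -/

import Mathlib

open MeasureTheory
open scoped ContDiff

noncomputable section

/-- The total surface measure `ω_k = |S^k|` of the unit sphere `S^k ⊂ ℝ^(k+1)`. -/
def sphereArea (k : ℕ) : ℝ :=
  ((volume : Measure (EuclideanSpace ℝ (Fin (k + 1)))).toSphere).real Set.univ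

/-- The linear map `x ↦ A x` on `ℝⁿ` with `A = diag (a₁, …, aₙ)`. -/
def diagMap {n : ℕ} (a : Fin n → ℝ) :
    EuclideanSpace ℝ (Fin n) →ₗ[ℝ] EuclideanSpace ℝ (Fin n) :=
  Matrix.toEuclideanLin (Matrix.diagonal a)

/-- The solid (open) ellipsoid with semi-principal axes `a₁, …, aₙ`. -/
def solidEllipsoid {n : ℕ} (a : Fin n → ℝ) : Set (EuclideanSpace ℝ (Fin n)) :=
  {x | ∑ i, x i ^ 2 / a i ^ 2 < 1}

/-- The spherical mean `(M f)(z, r)`: the average of `f` over the sphere with center `z` and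
radius `r`, taken with respect to the standard surface measure of `S^(n-1)`. -/
def sphericalMean {n : ℕ} (f : EuclideanSpace ℝ (Fin n) → ℝ)
    (z : EuclideanSpace ℝ (Fin n)) (r : ℝ) : ℝ :=
  1 / sphereArea (n - 1) *
    ∫ w : Metric.sphere (0 : EuclideanSpace ℝ (Fin n)) 1,
      f (z + r • (w : EuclideanSpace ℝ (Fin n)))
        ∂(volume : Measure (EuclideanSpace ℝ (Fin n))).toSphere

/-- The operator `D_r = (2 r)⁻¹ ∂_r`, differentiation with respect to `r²`. -/
def radialD (g : ℝ → ℝ) : ℝ → ℝ := fun r => 1 / (2 * r) * deriv g r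

/-- The filtered spherical means `(D_r^(n-3) r^(n-2) M f)(z, r)`. -/
def filteredMean {n : ℕ} (f : EuclideanSpace ℝ (Fin n) → ℝ)
    (z : EuclideanSpace ℝ (Fin n)) : ℝ → ℝ :=
  radialD^[n - 3] (fun r => r ^ (n - 2) * sphericalMean f z r)

/-- The function `x ↦ ∫_{S^(n-1)} (D_r^(n-3) r^(n-2) M f)(A σ, |x - A σ|) dσ`. -/
def backProjection {n : ℕ} (a : Fin n → ℝ) (f : EuclideanSpace ℝ (Fin n) → ℝ)
    (x : EuclideanSpace ℝ (Fin n)) : ℝ :=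
  ∫ σ : Metric.sphere (0 : EuclideanSpace ℝ (Fin n)) 1,
    filteredMean f (diagMap a σ) ‖x - diagMap a σ‖
      ∂(volume : Measure (EuclideanSpace ℝ (Fin n))).toSphere

/-- The partial derivative `∂u/∂x_i`. -/
def partialD {n : ℕ} (i : Fin n) (u : EuclideanSpace ℝ (Fin n) → ℝ) :
    EuclideanSpace ℝ (Fin n) → ℝ :=
  fun x => lineDeriv ℝ u x (EuclideanSpace.single i 1)

/-- The Laplacian with respect to `A x`, `Δ_{Ax} = ∑ i, a_i⁻² ∂²/∂x_i²`. -/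
def laplacianDiag {n : ℕ} (a : Fin n → ℝ) (u : EuclideanSpace ℝ (Fin n) → ℝ)
    (x : EuclideanSpace ℝ (Fin n)) : ℝ :=
  ∑ i, 1 / a i ^ 2 * partialD i (partialD i u) x

/-- The constant `c_n = (-1)^((n-1)/2) ω_{n-2} (n-2)! 2^(3-n)`, for odd `n ≥ 3`. -/
def oddConst (n : ℕ) : ℝ :=
  (-1) ^ ((n - 1) / 2) * sphereArea (n - 2) * (Nat.factorial (n - 2) : ℝ) *
    (2 : ℝ) ^ (3 - (n : ℤ))

end

/-! Write `n = 2p + 3`, so that the filter `D_r^(n-3)` has even order `2p`. On `E` the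
backprojection is a constant multiple of the potential `∫ f(y) |A(y - x)|^(2-n) dy`, whose kernel
is, up to a constant, the fundamental solution of `Δ_{Ax}` (`laplacianDiag_diagPotential`). The
formula follows by applying `Δ_{Ax}`.

For the first claim, test the filtered mean against an approximate identity `φ_ε` in the variable
`r²`. Since `D_r` is differentiation in `r²`, all `2p` derivatives move onto `φ_ε`
(`integral_iterate_radialD_mul`). Polar coordinates around `Aσ` produce the integral of `f(y)
φ_ε^(2p)(|x - Aσ|² - |y - Aσ|²)`. The terms `|Aσ|²` cancel, so the argument is `2⟨A(y - x), σ⟩ - c`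
with `c = |y|² - |x|²`, affine in `σ`. The integral over `σ` is therefore zonal, and for odd `n` its
weight is the polynomial `(1 - s²)^p` of degree `2p`. After `2p` integrations by parts only a
constant weight is left, and the value is independent of `c` and `ε` once `|c| + ε ≤ 2|A(y - x)|`
(`integral_sphere_iteratedDeriv`).

This inequality is where the ellipsoid enters: `c = ⟨A(y - x), A⁻¹(y + x)⟩` with `|A⁻¹y| ≤ 1` on the
support of `f` and `|A⁻¹x| < 1` leaves a margin proportional to `|A(y - x)|`
(`abs_norm_sq_sub_norm_sq_le`). Dominated convergence takes care of `y` near `x`, and comparing the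
limits as `ε → 0` gives `backProjection_eq_diagPotential`. -/

open Set Filter Topology Module Convolution

/-! ### Polar coordinates. -/

section Polar

variable {E : Type*} [NormedAddCommGroup E] [NormedSpace ℝ E]
  [FiniteDimensional ℝ E] [MeasurableSpace E] [BorelSpace E] [Nontrivial E]
  (μ : Measure E) [μ.IsAddHaarMeasure]

theorem integral_volumeIoiPow (k : ℕ) (g : ℝ → ℝ) :
    ∫ r : Ioi (0 : ℝ), g r ∂(Measure.volumeIoiPow k) = ∫ r in Ioi (0 : ℝ), r ^ k * g r := by
  simp only [Measure.volumeIoiPow, ENNReal.ofReal]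
  rw [integral_withDensity_eq_integral_smul,
    integral_subtype_comap measurableSet_Ioi fun r ↦ Real.toNNReal (r ^ k) • g r,
    setIntegral_congr_fun measurableSet_Ioi fun x hx ↦ ?_]
  · simp only [NNReal.smul_def, Real.coe_toNNReal _ (pow_nonneg (le_of_lt hx) _), smul_eq_mul]
  · exact (measurable_subtype_coe.pow_const _).real_toNNReal

theorem integral_polar_prod {f : E → ℝ} (hf : Integrable f μ) :
    Integrable (fun p : Metric.sphere (0 : E) 1 × Ioi (0 : ℝ) => f ((p.2 : ℝ) • (p.1 : E)))
        (μ.toSphere.prod (Measure.volumeIoiPow (finrank ℝ E - 1))) ∧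
      ∫ x, f x ∂μ = ∫ p : Metric.sphere (0 : E) 1 × Ioi (0 : ℝ), f ((p.2 : ℝ) • (p.1 : E))
        ∂(μ.toSphere.prod (Measure.volumeIoiPow (finrank ℝ E - 1))) := by
  have hmp := μ.measurePreserving_homeomorphUnitSphereProd
  have hemb := (homeomorphUnitSphereProd E).measurableEmbedding
  let g : Metric.sphere (0 : E) 1 × Ioi (0 : ℝ) → ℝ := fun p => f ((p.2 : ℝ) • (p.1 : E))
  have hg : ∀ x : ({(0 : E)}ᶜ : Set E), g (homeomorphUnitSphereProd E x) = f x := by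
    intro x
    have : (x : E) ≠ 0 := x.2
    simp [g, smul_smul, this]
  constructor
  · change Integrable g _
    rw [← hmp.integrable_comp_emb hemb]
    have : g ∘ homeomorphUnitSphereProd E = fun x : ({(0 : E)}ᶜ : Set E) => f x := funext hg
    rw [this]
    have h2 : IntegrableOn f ({(0 : E)}ᶜ) μ := hf.integrableOn
    rwa [integrableOn_iff_comap_subtypeVal (measurableSet_singleton _).compl] at h2
  · change _ = ∫ p, g p ∂_
    rw [← hmp.integral_comp hemb]
    simp only [hg]
    rw [integral_subtype_comap (measurableSet_singleton _).compl fun x ↦ f x,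
      restrict_compl_singleton]

/-- Integration in polar coordinates. -/
theorem integral_polar {f : E → ℝ} (hf : Integrable f μ) :
    ∫ x, f x ∂μ =
      ∫ σ : Metric.sphere (0 : E) 1,
        (∫ r in Ioi (0 : ℝ), r ^ (finrank ℝ E - 1) * f (r • (σ : E))) ∂μ.toSphere := by
  obtain ⟨h1, h2⟩ := integral_polar_prod μ hf
  rw [h2, integral_prod _ h1]
  refine integral_congr_ae (Eventually.of_forall fun σ => ?_)
  exact integral_volumeIoiPow _ fun r => f (r • (σ : E))

/-- Integration in polar coordinates, the radial variable being the outer one. -/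
theorem integral_polar_radial {f : E → ℝ} (hf : Integrable f μ) :
    ∫ x, f x ∂μ = ∫ r in Ioi (0 : ℝ), r ^ (finrank ℝ E - 1) *
      ∫ σ : Metric.sphere (0 : E) 1, f (r • (σ : E)) ∂μ.toSphere := by
  obtain ⟨h1, h2⟩ := integral_polar_prod μ hf
  rw [h2, integral_prod_symm _ h1]
  exact integral_volumeIoiPow _ fun r =>
    ∫ σ : Metric.sphere (0 : E) 1, f (r • (σ : E)) ∂μ.toSphere

end Polar

/-! ### Integrals of zonal functions over the sphere. -/

theorem sphereArea_pos (k : ℕ) : 0 < sphereArea k := by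
  unfold sphereArea
  refine ENNReal.toReal_pos ?_ (measure_ne_top _ _)
  rw [Measure.measure_univ_ne_zero]
  exact Measure.toSphere_ne_zero _

theorem integral_comp_norm_eq_sphereArea {m : ℕ} (f : ℝ → ℝ) :
    ∫ x : EuclideanSpace ℝ (Fin (m + 1)), f ‖x‖ =
      sphereArea m * ∫ y in Ioi (0 : ℝ), y ^ m * f y := by
  rw [integral_fun_norm_addHaar, sphereArea, Measure.toSphere_real_apply_univ]
  simp [mul_assoc]

/-- Splitting off the first coordinate of Euclidean space. -/
theorem exists_measurePreserving_split {m : ℕ} (e : EuclideanSpace ℝ (Fin (m + 2)))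
    (he : ‖e‖ = 1) :
    ∃ T : EuclideanSpace ℝ (Fin (m + 2)) ≃ᵐ ℝ × EuclideanSpace ℝ (Fin (m + 1)),
      MeasurePreserving T volume volume ∧
      (∀ x, (T x).1 = inner ℝ e x) ∧ ∀ x, ‖x‖ ^ 2 = (T x).1 ^ 2 + ‖(T x).2‖ ^ 2 := by
  have hor : Orthonormal ℝ (({0} : Set (Fin (m + 2))).domRestrict fun _ => e) := by
    constructor
    · intro i; simpa using he
    · intro i j hij
      exact absurd (Subsingleton.elim i j) hij
  obtain ⟨b, hb⟩ := hor.exists_orthonormalBasis_extension_of_card_eq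
    (v := fun _ => e) (by simp)
  have hb0 : b 0 = e := hb 0 rfl
  let T₁ := b.measurableEquiv
  let T₂ := (MeasurableEquiv.toLp 2 (Fin (m + 2) → ℝ)).symm
  let T₃ := MeasurableEquiv.piFinSuccAbove (fun _ : Fin (m + 2) => ℝ) 0
  let T₄ := (MeasurableEquiv.refl ℝ).prodCongr (MeasurableEquiv.toLp 2 (Fin (m + 1) → ℝ))
  refine ⟨((T₁.trans T₂).trans T₃).trans T₄, ?_, ?_, ?_⟩
  · refine MeasurePreserving.trans (MeasurePreserving.trans (MeasurePreserving.trans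
      b.measurePreserving_measurableEquiv
      (EuclideanSpace.volume_preserving_symm_measurableEquiv_toLp _))
      (volume_preserving_piFinSuccAbove _ 0)) ?_
    exact (MeasurePreserving.id volume).prod (PiLp.volume_preserving_toLp _)
  · intro x
    have : (b.repr x) 0 = inner ℝ e x := by rw [b.repr_apply_apply, hb0]
    rw [← this]; rfl
  · intro x
    have : ‖x‖ ^ 2 = ‖b.repr x‖ ^ 2 := by simp
    rw [this, EuclideanSpace.norm_sq_eq, Fin.sum_univ_succ, EuclideanSpace.norm_sq_eq]
    simp only [Real.norm_eq_abs, sq_abs]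
    rfl

theorem integral_Ioi_pow_mul_indicator (m : ℕ) (c : ℝ) :
    ∫ r in Ioi (0 : ℝ), r ^ m * (if r < 1 then c else 0) = c / (m + 1) := by
  have h1 : ∀ r : ℝ, r ^ m * (if r < 1 then c else 0) = (Iio 1).indicator (fun r => r ^ m * c) r := by
    intro r; by_cases h : r < 1 <;> simp [h]
  simp_rw [h1]
  rw [setIntegral_indicator measurableSet_Iio, Ioi_inter_Iio, ← integral_Ioc_eq_integral_Ioo,
    ← intervalIntegral.integral_of_le zero_le_one, intervalIntegral.integral_mul_const,
    integral_pow]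
  simp; ring

/-- Integration of a zonal function over the half plane, in polar coordinates. -/
theorem integral_halfPlane_zonal (m : ℕ) {k : ℝ → ℝ} (hk : Continuous k) {C : ℝ}
    (hC : ∀ s, |k s| ≤ C) :
    ∫ t : ℝ, ∫ q in Ioi (0 : ℝ), q ^ m *
        (if √(t ^ 2 + q ^ 2) < 1 then k (t / √(t ^ 2 + q ^ 2)) else 0) =
      (∫ θ in (0 : ℝ)..Real.pi, k (Real.cos θ) * Real.sin θ ^ m) / (m + 2) := by
  let G : ℝ × ℝ → ℝ := fun p => if 0 < p.2 ∧ √(p.1 ^ 2 + p.2 ^ 2) < 1 then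
    p.2 ^ m * k (p.1 / √(p.1 ^ 2 + p.2 ^ 2)) else 0
  have hGm : Measurable G := by
    have hkm := hk.measurable
    have h1 : Measurable fun p : ℝ × ℝ => √(p.1 ^ 2 + p.2 ^ 2) := by fun_prop
    have h2 : Measurable fun p : ℝ × ℝ => p.2 ^ m * k (p.1 / √(p.1 ^ 2 + p.2 ^ 2)) :=
      (measurable_snd.pow_const m).mul (hkm.comp (measurable_fst.div h1))
    refine Measurable.ite ?_ h2 measurable_const
    exact (measurableSet_lt measurable_const measurable_snd).inter
      (measurableSet_lt h1 measurable_const)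
  have hGi : Integrable G := by
    have hs : Function.support G ⊆ Icc (-1) 1 ×ˢ Icc (-1) 1 := by
      intro p hp
      have : 0 < p.2 ∧ √(p.1 ^ 2 + p.2 ^ 2) < 1 := by
        by_contra h; exact hp (if_neg h)
      have h2 : p.1 ^ 2 + p.2 ^ 2 < 1 := by
        have := (Real.sqrt_lt' one_pos).1 this.2; simpa using this
      refine ⟨?_, ?_⟩ <;> constructor <;> nlinarith [sq_nonneg p.1, sq_nonneg p.2]
    rw [← integrableOn_iff_integrable_of_support_subset hs]
    refine Measure.integrableOn_of_bounded (M := C) ?_ hGm.aestronglyMeasurable ?_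
    · exact (isCompact_Icc.prod isCompact_Icc).measure_lt_top.ne
    · refine Eventually.of_forall fun p => ?_
      have hC0 : 0 ≤ C := (abs_nonneg _).trans (hC 0)
      by_cases h : 0 < p.2 ∧ √(p.1 ^ 2 + p.2 ^ 2) < 1
      · simp only [G, if_pos h, Real.norm_eq_abs, abs_mul, abs_pow, abs_of_pos h.1]
        have h2 : p.1 ^ 2 + p.2 ^ 2 < 1 := by
          have := (Real.sqrt_lt' one_pos).1 h.2; simpa using this
        have h3 : p.2 ^ m ≤ 1 := pow_le_one₀ h.1.le (by nlinarith [sq_nonneg p.1])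
        calc p.2 ^ m * |k _| ≤ 1 * C := by gcongr; exact hC _
          _ = C := one_mul _
      · simp only [G, if_neg h, norm_zero, hC0]
  have e1 : ∫ t : ℝ, ∫ q in Ioi (0 : ℝ), q ^ m *
        (if √(t ^ 2 + q ^ 2) < 1 then k (t / √(t ^ 2 + q ^ 2)) else 0) = ∫ p, G p := by
    rw [Measure.volume_eq_prod, integral_prod _ hGi]
    refine integral_congr_ae (Eventually.of_forall fun t => ?_)
    simp only
    rw [← integral_indicator measurableSet_Ioi]
    refine integral_congr_ae (Eventually.of_forall fun q => ?_)
    by_cases h : 0 < q <;> by_cases h' : √(t ^ 2 + q ^ 2) < 1 <;> simp [G, h, h']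
  rw [e1, ← integral_comp_polarCoord_symm]
  -- The angle runs over `(-π, π)`; its nonpositive part corresponds to `q ≤ 0`, where `G` vanishes.
  have e2 : ∀ p ∈ polarCoord.target, p.1 • G (polarCoord.symm p) =
      (p.1 ^ (m + 1) * (if p.1 < 1 then 1 else 0)) *
        (Ioi 0).indicator (fun θ => k (Real.cos θ) * Real.sin θ ^ m) p.2 := by
    rintro ⟨r, θ⟩ ⟨hr, hθ⟩
    simp only [mem_Ioi, mem_Ioo] at hr hθ
    have hn : (r * Real.cos θ) ^ 2 + (r * Real.sin θ) ^ 2 = r ^ 2 := by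
      nlinarith [Real.sin_sq_add_cos_sq θ]
    simp only [polarCoord_symm_apply, G, hn, Real.sqrt_sq hr.le, smul_eq_mul]
    rw [mul_div_cancel_left₀ _ hr.ne']
    by_cases h0 : 0 < θ
    · have hs := Real.sin_pos_of_pos_of_lt_pi h0 hθ.2
      have : 0 < r * Real.sin θ := by positivity
      by_cases h1 : r < 1
      · simp [h0, h1, this]; ring
      · simp [h1]
    · have hs := Real.sin_nonpos_of_nonpos_of_neg_pi_le (not_lt.1 h0) hθ.1.le
      have : ¬ (0 < r * Real.sin θ) := by nlinarith
      simp [h0, this]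
  rw [setIntegral_congr_fun polarCoord.open_target.measurableSet e2]
  have ht : polarCoord.target = Ioi 0 ×ˢ Ioo (-Real.pi) Real.pi := rfl
  rw [ht, Measure.volume_eq_prod, setIntegral_prod_mul (fun r : ℝ => r ^ (m + 1) * (if r < 1 then 1 else 0)),
    integral_Ioi_pow_mul_indicator, setIntegral_indicator measurableSet_Ioi, Ioo_inter_Ioi,
    max_eq_right (by linarith [Real.pi_pos]), intervalIntegral.integral_of_le Real.pi_pos.le,
    integral_Ioc_eq_integral_Ioo]
  push_cast
  ring

/-- The integral of a zonal function over the unit sphere. -/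
theorem integral_sphere_zonal (m : ℕ) (e : EuclideanSpace ℝ (Fin (m + 2))) (he : ‖e‖ = 1)
    {k : ℝ → ℝ} (hk : Continuous k) {C : ℝ} (hC : ∀ s, |k s| ≤ C) :
    ∫ σ : Metric.sphere (0 : EuclideanSpace ℝ (Fin (m + 2))) 1,
        k (inner ℝ e (σ : EuclideanSpace ℝ (Fin (m + 2))))
          ∂(volume : Measure (EuclideanSpace ℝ (Fin (m + 2)))).toSphere =
      sphereArea m * ∫ θ in (0 : ℝ)..Real.pi, k (Real.cos θ) * Real.sin θ ^ m := by
  -- Homogeneous extension of degree 0, cut off at the unit ball to be integrable. The cutoff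
  -- contributes a factor `1 / (m + 2)` in each of the two evaluations of `∫ F` below, and it
  -- cancels at the end.
  let F : EuclideanSpace ℝ (Fin (m + 2)) → ℝ := fun x =>
    if ‖x‖ < 1 then k (inner ℝ e x / ‖x‖) else 0
  have hFm : Measurable F := by
    refine Measurable.ite (measurableSet_lt measurable_norm measurable_const) ?_ measurable_const
    exact hk.measurable.comp (Measurable.div (by fun_prop) measurable_norm)
  have hFi : Integrable F := by
    have hs : Function.support F ⊆ Metric.ball 0 1 := by
      intro p hp
      rw [mem_ball_zero_iff]
      by_contra h; exact hp (if_neg h)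
    rw [← integrableOn_iff_integrable_of_support_subset hs]
    refine Measure.integrableOn_of_bounded (M := C) measure_ball_lt_top.ne
      hFm.aestronglyMeasurable ?_
    refine Eventually.of_forall fun p => ?_
    have hC0 : 0 ≤ C := (abs_nonneg _).trans (hC 0)
    by_cases h : ‖p‖ < 1
    · simp only [F, if_pos h]; exact hC _
    · simp only [F, if_neg h, norm_zero, hC0]
  have e1 := integral_polar volume hFi
  have e2 : ∀ σ : Metric.sphere (0 : EuclideanSpace ℝ (Fin (m + 2))) 1,
      (∫ r in Ioi (0 : ℝ), r ^ (finrank ℝ (EuclideanSpace ℝ (Fin (m + 2))) - 1) *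
        F (r • (σ : EuclideanSpace ℝ (Fin (m + 2))))) =
      k (inner ℝ e (σ : EuclideanSpace ℝ (Fin (m + 2)))) / (m + 2) := by
    intro σ
    have hσ : ‖(σ : EuclideanSpace ℝ (Fin (m + 2)))‖ = 1 := by simp
    have := integral_Ioi_pow_mul_indicator (m + 1)
      (k (inner ℝ e (σ : EuclideanSpace ℝ (Fin (m + 2)))))
    push_cast at this
    rw [add_assoc, one_add_one_eq_two] at this
    rw [← this]
    refine setIntegral_congr_fun measurableSet_Ioi fun r (hr : 0 < r) => ?_
    simp only [F, norm_smul, hσ, mul_one, Real.norm_eq_abs, abs_of_pos hr, inner_smul_right,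
      mul_div_cancel_left₀ _ hr.ne']
    simp
  simp_rw [e2] at e1
  rw [integral_div] at e1
  -- Second evaluation of `∫ F`: split along `e` and its orthogonal complement, where the integrand
  -- depends only on the norm.
  obtain ⟨T, hT, hT1, hT2⟩ := exists_measurePreserving_split e he
  let G : ℝ × EuclideanSpace ℝ (Fin (m + 1)) → ℝ := fun p =>
    if √(p.1 ^ 2 + ‖p.2‖ ^ 2) < 1 then k (p.1 / √(p.1 ^ 2 + ‖p.2‖ ^ 2)) else 0
  have hGF : G ∘ T = F := by
    funext x
    have : √((T x).1 ^ 2 + ‖(T x).2‖ ^ 2) = ‖x‖ := by rw [← hT2, Real.sqrt_sq (norm_nonneg x)]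
    simp only [Function.comp, G, F]
    rw [this, hT1]
  have hGi : Integrable G := by
    rw [← hT.integrable_comp_emb T.measurableEmbedding, hGF]; exact hFi
  have e3 : ∫ x, F x = ∫ p, G p := by
    rw [← hT.integral_comp T.measurableEmbedding, ← hGF]; rfl
  rw [Measure.volume_eq_prod, integral_prod _ hGi] at e3
  have e4 : ∀ t : ℝ, ∫ q : EuclideanSpace ℝ (Fin (m + 1)), G (t, q) =
      sphereArea m * ∫ q in Ioi (0 : ℝ), q ^ m *
        (if √(t ^ 2 + q ^ 2) < 1 then k (t / √(t ^ 2 + q ^ 2)) else 0) := fun t =>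
    integral_comp_norm_eq_sphereArea
      (fun q => if √(t ^ 2 + q ^ 2) < 1 then k (t / √(t ^ 2 + q ^ 2)) else 0)
  simp_rw [e4] at e3
  rw [integral_const_mul, integral_halfPlane_zonal m hk hC, e1] at e3
  have : (m : ℝ) + 2 ≠ 0 := by positivity
  field_simp at e3
  exact e3

/-! ### Derivatives of a bump function integrated over the sphere. -/

theorem hasDerivAt_iteratedDeriv_of_contDiff {φ : ℝ → ℝ} (hφ : ContDiff ℝ ∞ φ) (j : ℕ) (s : ℝ) :
    HasDerivAt (iteratedDeriv j φ) (iteratedDeriv (j + 1) φ s) s := by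
  rw [iteratedDeriv_succ]
  exact ((hφ.differentiable_iteratedDeriv j (mod_cast WithTop.coe_lt_top _)) s).hasDerivAt

theorem continuous_iteratedDeriv_of_contDiff {φ : ℝ → ℝ} (hφ : ContDiff ℝ ∞ φ) (j : ℕ) :
    Continuous (iteratedDeriv j φ) :=
  hφ.continuous_iteratedDeriv j (mod_cast le_top)

theorem iteratedDeriv_eq_zero_of_notMem_tsupport {φ : ℝ → ℝ} (j : ℕ) {s : ℝ}
    (hs : s ∉ tsupport φ) : iteratedDeriv j φ s = 0 := by
  induction j generalizing s with
  | zero => simpa using image_eq_zero_of_notMem_tsupport hs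
  | succ j ih =>
    by_contra h
    rw [iteratedDeriv_succ] at h
    refine hs ?_
    have h1 := support_deriv_subset h
    refine closure_minimal (fun x hx => ?_) (isClosed_tsupport φ) h1
    by_contra hx'
    exact hx (ih hx')

/-- Each integration by parts costs a factor `-1 / b`. The boundary terms vanish because the
arguments `b - c` and `-b - c` at `s = ±1` lie outside the support of `φ`. -/
theorem integral_iteratedDeriv_comp_mul_polynomial {φ : ℝ → ℝ} (hφ : ContDiff ℝ ∞ φ) {b c : ℝ}
    (hb : b ≠ 0) (h1 : b - c ∉ tsupport φ) (h2 : -b - c ∉ tsupport φ) (j : ℕ) (P : Polynomial ℝ) :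
    ∫ s in (-1 : ℝ)..1, iteratedDeriv j φ (b * s - c) * P.eval s =
      (-1 / b) ^ j *
        ∫ s in (-1 : ℝ)..1, φ (b * s - c) * (Polynomial.derivative^[j] P).eval s := by
  have hc := continuous_iteratedDeriv_of_contDiff hφ
  induction j generalizing P with
  | zero => simp
  | succ j ih =>
    have hd : ∀ s, HasDerivAt (fun s => b⁻¹ * iteratedDeriv j φ (b * s - c))
        (iteratedDeriv (j + 1) φ (b * s - c)) s := by
      intro s
      have h := (hasDerivAt_iteratedDeriv_of_contDiff hφ j (b * s - c)).comp s
        (((hasDerivAt_id s).const_mul b).sub_const c)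
      refine (h.const_mul b⁻¹).congr_deriv ?_
      rw [mul_one, mul_comm, mul_assoc, mul_inv_cancel₀ hb, mul_one]
    have := intervalIntegral.integral_deriv_mul_eq_sub_of_hasDerivAt (a := -1) (b := 1)
      (fun s _ => (hd s).continuousAt.continuousWithinAt)
      (fun s _ => (P.hasDerivAt s).continuousAt.continuousWithinAt)
      (fun s _ => hd s) (fun s _ => P.hasDerivAt s)
      (((hc (j+1)).comp (by fun_prop)).intervalIntegrable _ _)
      (P.derivative.continuous.intervalIntegrable _ _)
    rw [intervalIntegral.integral_add] at this
    · have z1 : iteratedDeriv j φ (b * 1 - c) = 0 :=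
        iteratedDeriv_eq_zero_of_notMem_tsupport j (by simpa using h1)
      have z2 : iteratedDeriv j φ (b * (-1) - c) = 0 :=
        iteratedDeriv_eq_zero_of_notMem_tsupport j (by simpa using h2)
      rw [z1, z2] at this
      simp only [mul_zero, zero_mul, sub_zero, mul_assoc] at this
      rw [intervalIntegral.integral_const_mul, ih, ← Function.iterate_succ_apply] at this
      rw [pow_succ]
      linear_combination this
    · exact (((hc (j+1)).comp (by fun_prop)).mul P.continuous).intervalIntegrable _ _
    · exact ((continuous_const.mul ((hc j).comp (by fun_prop))).mul
        P.derivative.continuous).intervalIntegrable _ _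

/-- The order of differentiation equals the degree, so only the leading coefficient `(-1)^p`
survives. -/
theorem iterate_derivative_one_sub_sq_pow (p : ℕ) :
    Polynomial.derivative^[2 * p] ((1 - Polynomial.X ^ 2 : Polynomial ℝ) ^ p) =
      Polynomial.C ((-1 : ℝ) ^ p * ((2 * p).factorial : ℝ)) := by
  have hd : ((1 - Polynomial.X ^ 2 : Polynomial ℝ)).natDegree = 2 := by compute_degree!
  have hl : ((1 - Polynomial.X ^ 2 : Polynomial ℝ)).leadingCoeff = -1 := by
    rw [Polynomial.leadingCoeff, hd]; simp [Polynomial.coeff_one]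
  have hP : ((1 - Polynomial.X ^ 2 : Polynomial ℝ) ^ p).natDegree = 2 * p := by
    rw [Polynomial.natDegree_pow, hd, mul_comm]
  have h0 : (Polynomial.derivative^[2 * p] ((1 - Polynomial.X ^ 2 : Polynomial ℝ) ^ p)).natDegree
      = 0 := by
    have := Polynomial.natDegree_iterate_derivative ((1 - Polynomial.X ^ 2 : Polynomial ℝ) ^ p)
      (2 * p)
    omega
  rw [Polynomial.eq_C_of_natDegree_eq_zero h0, Polynomial.coeff_iterate_derivative, zero_add,
    Nat.descFactorial_self]
  congr 1
  have : ((1 - Polynomial.X ^ 2 : Polynomial ℝ) ^ p).coeff (2 * p) = (-1) ^ p := by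
    rw [← hP, Polynomial.coeff_natDegree, Polynomial.leadingCoeff_pow, hl]
  rw [this, nsmul_eq_mul, mul_comm]

/-- The integral over the sphere of a derivative of even order `2 p` of a bump function, evaluated
along an affine function, in dimension `2 p + 3`. -/
theorem integral_sphere_iteratedDeriv {p : ℕ} {φ : ℝ → ℝ} (hφ : ContDiff ℝ ∞ φ)
    (u : EuclideanSpace ℝ (Fin (2 * p + 3))) {c ε : ℝ} (hε : tsupport φ ⊆ Ioo (-ε) ε)
    (hu : |c| + ε ≤ 2 * ‖u‖) (h0 : u ≠ 0) :
    ∫ σ : Metric.sphere (0 : EuclideanSpace ℝ (Fin (2 * p + 3))) 1,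
        iteratedDeriv (2 * p) φ (2 * inner ℝ u (σ : EuclideanSpace ℝ (Fin (2 * p + 3))) - c)
          ∂(volume : Measure (EuclideanSpace ℝ (Fin (2 * p + 3)))).toSphere =
      sphereArea (2 * p + 1) * ((-1) ^ p * ((2 * p).factorial : ℝ)) * (∫ s, φ s) /
        (2 * ‖u‖) ^ (2 * p + 1) := by
  have hup : 0 < ‖u‖ := norm_pos_iff.2 h0
  have hcs : HasCompactSupport φ :=
    HasCompactSupport.of_support_subset_isCompact isCompact_Icc
      ((subset_tsupport φ).trans (hε.trans Ioo_subset_Icc_self))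
  have hc := continuous_iteratedDeriv_of_contDiff hφ
  obtain ⟨C, hC⟩ : ∃ C, ∀ s, |iteratedDeriv (2 * p) φ s| ≤ C := by
    have : HasCompactSupport (iteratedDeriv (2 * p) φ) :=
      HasCompactSupport.of_support_subset_isCompact hcs.isCompact fun s hs => by
        by_contra h; exact hs (iteratedDeriv_eq_zero_of_notMem_tsupport _ h)
    exact (hc _).bounded_above_of_compact_support this
  set b := 2 * ‖u‖ with hb
  have hbp : 0 < b := by positivity
  let e := ‖u‖⁻¹ • u
  have he : ‖e‖ = 1 := by simp [e, norm_smul, hup.ne']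
  have hin : ∀ σ : EuclideanSpace ℝ (Fin (2 * p + 3)),
      2 * inner ℝ u σ = b * inner ℝ e σ := by
    intro σ
    simp only [e, inner_smul_left, b]
    simp; field_simp
  simp_rw [hin]
  rw [integral_sphere_zonal (2 * p + 1) e he (k := fun s => iteratedDeriv (2 * p) φ (b * s - c))
    ((hc _).comp (by fun_prop)) (fun s => hC _)]
  -- Substituting `s = cos θ` leaves the even power `sin^(2p) θ = (1 - s²)^p`; this is where the
  -- parity of the dimension matters.
  have e1 : ∫ θ in (0 : ℝ)..Real.pi, iteratedDeriv (2 * p) φ (b * Real.cos θ - c) *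
      Real.sin θ ^ (2 * p + 1) = ∫ s in (-1 : ℝ)..1, iteratedDeriv (2 * p) φ (b * s - c) *
        ((1 - Polynomial.X ^ 2 : Polynomial ℝ) ^ p).eval s := by
    have := intervalIntegral.integral_comp_mul_deriv (a := 0) (b := Real.pi)
      (f := Real.cos) (f' := fun θ => - Real.sin θ)
      (g := fun s => iteratedDeriv (2 * p) φ (b * s - c) *
        ((1 - Polynomial.X ^ 2 : Polynomial ℝ) ^ p).eval s)
      (fun x _ => Real.hasDerivAt_cos x) (by fun_prop)
      (((hc _).comp (by fun_prop)).mul (Polynomial.continuous _))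
    rw [Real.cos_zero, Real.cos_pi, intervalIntegral.integral_symm (-1) 1] at this
    rw [eq_comm, ← neg_inj, ← this, ← intervalIntegral.integral_neg]
    refine intervalIntegral.integral_congr fun θ _ => ?_
    have : 1 - Real.cos θ ^ 2 = Real.sin θ ^ 2 := by rw [Real.sin_sq]
    simp [this]; ring
  have m1 : b - c ∉ tsupport φ := fun h => by
    have := (hε h).2; have := neg_abs_le c; have := le_abs_self c; linarith
  have m2 : -b - c ∉ tsupport φ := fun h => by
    have := (hε h).1; have := neg_abs_le c; have := le_abs_self c; linarith
  rw [e1, integral_iteratedDeriv_comp_mul_polynomial hφ hbp.ne' m1 m2,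
    iterate_derivative_one_sub_sq_pow]
  simp only [Polynomial.eval_C]
  rw [intervalIntegral.integral_mul_const, intervalIntegral.integral_comp_mul_sub φ hbp.ne',
    intervalIntegral.integral_eq_integral_of_support_subset]
  · rw [div_pow, (even_two_mul p).neg_one_pow]
    simp only [smul_eq_mul]
    field_simp
    ring
  -- By `hu` the range `[-b - c, b - c]` of the argument covers the support of `φ`, so the full mass
  -- of `φ` appears and `c` drops out.
  · intro s hs
    have h := hε (subset_tsupport φ hs)
    have := neg_abs_le c; have := le_abs_self c
    constructor <;> linarith [h.1, h.2]

/-! ### Smoothness of spherical means and filtered means. -/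

/-- Integrals of smooth functions over a compact space of parameters are smooth. -/
theorem contDiff_integral_of_compact {E V : Type} [NormedAddCommGroup E] [NormedSpace ℝ E]
    [FiniteDimensional ℝ E] [NormedAddCommGroup V] [NormedSpace ℝ V] {K : Set V}
    [CompactSpace K] [SecondCountableTopology K] [MeasurableSpace K] [OpensMeasurableSpace K]
    (μ : Measure K) [IsFiniteMeasure μ] (n : ℕ) {G : Type} [NormedAddCommGroup G] [NormedSpace ℝ G]
    {F : E × V → G} (hF : ContDiff ℝ ∞ F) :
    ContDiff ℝ n fun p => ∫ v : K, F (p, v) ∂μ := by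
  -- `G` varies because the derivative in the parameter takes values in `E →L[ℝ] G`.
  induction n generalizing G with
  | zero =>
    have := continuous_parametric_integral_of_continuous (μ := μ) (s := univ)
      (f := fun (p : E) (v : K) => F (p, v))
      (hF.continuous.comp (by fun_prop : Continuous fun q : E × K => (q.1, (q.2 : V))))
      isCompact_univ
    simp only [Measure.restrict_univ] at this
    exact contDiff_zero.2 this
  | succ n ih =>
    let F' : E × V → (E →L[ℝ] G) := fun q =>
      (fderiv ℝ F q).comp (ContinuousLinearMap.inl ℝ E V)
    have hF' : ContDiff ℝ ∞ F' :=
      (hF.fderiv_right (m := ∞) (by simp)).clm_comp contDiff_const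
    have hd : ∀ p v, HasFDerivAt (fun p => F (p, v)) (F' (p, v)) p := by
      intro p v
      have h1 : HasFDerivAt F (fderiv ℝ F (p, v)) (p, v) :=
        (hF.differentiable (by simp) (p, v)).hasFDerivAt
      exact h1.comp p (hasFDerivAt_prodMk_left p v)
    rw [show ((n + 1 : ℕ) : WithTop ℕ∞) = (n : WithTop ℕ∞) + 1 by push_cast; rfl,
      contDiff_succ_iff_hasFDerivAt]
    refine ⟨fun p => ∫ v : K, F' (p, v) ∂μ, ih hF', fun p => ?_⟩
    have hc : ∀ p : E, Continuous fun v : K => F (p, v) := fun p =>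
      hF.continuous.comp (by fun_prop)
    have hc' : ∀ p : E, Continuous fun v : K => F' (p, v) := fun p =>
      hF'.continuous.comp (by fun_prop)
    obtain ⟨U, hU, hpU⟩ := exists_compact_mem_nhds p
    have hcU : Continuous fun q : E × K => ‖F' (q.1, q.2)‖ :=
      (hF'.continuous.comp (by fun_prop : Continuous fun q : E × K => (q.1, (q.2 : V)))).norm
    obtain ⟨C, hC⟩ := ((hU.prod (isCompact_univ (X := K))).bddAbove_image hcU.continuousOn)
    refine hasFDerivAt_integral_of_dominated_of_fderiv_le (bound := fun _ => C) hpU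
      (Eventually.of_forall fun q => (hc q).aestronglyMeasurable)
      ?_ (hc' p).aestronglyMeasurable
      (Eventually.of_forall fun v q hq => hC ⟨(q, v), ⟨hq, mem_univ _⟩, rfl⟩)
      (integrable_const C) (Eventually.of_forall fun v q _ => hd q v)
    rw [← integrableOn_univ]
    exact (hc p).continuousOn.integrableOn_compact isCompact_univ

section

variable {n : ℕ} {f : EuclideanSpace ℝ (Fin n) → ℝ}

theorem contDiff_sphericalMean_uncurry (hf : ContDiff ℝ ∞ f) :
    ContDiff ℝ ∞ fun p : EuclideanSpace ℝ (Fin n) × ℝ => sphericalMean f p.1 p.2 := by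
  refine contDiff_const.mul (contDiff_infty.2 fun k => ?_)
  refine contDiff_integral_of_compact (E := EuclideanSpace ℝ (Fin n) × ℝ)
    (F := fun q => f (q.1.1 + q.1.2 • q.2)) _ k (hf.comp ?_)
  fun_prop

/-- Smoothness is needed jointly in center and radius, since the backprojection moves both with `σ`.
The factor `1 / (2 r)` confines it to `r > 0`. -/
theorem contDiffOn_radialD_uncurry {U : EuclideanSpace ℝ (Fin n) × ℝ → ℝ}
    (hU : ContDiffOn ℝ ∞ U (univ ×ˢ Ioi 0)) :
    ContDiffOn ℝ ∞ (fun p : EuclideanSpace ℝ (Fin n) × ℝ => radialD (fun r => U (p.1, r)) p.2)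
      (univ ×ˢ Ioi 0) := by
  have ho : IsOpen ((univ : Set (EuclideanSpace ℝ (Fin n))) ×ˢ Ioi (0 : ℝ)) :=
    isOpen_univ.prod isOpen_Ioi
  have h1 : ContDiffOn ℝ ∞ (fun p => 1 / (2 * p.2) * fderiv ℝ U p (0, 1)) (univ ×ˢ Ioi 0) := by
    refine ContDiffOn.mul ?_ ?_
    · refine contDiffOn_const.div (by fun_prop) fun p hp => ?_
      have : 0 < p.2 := hp.2
      positivity
    · exact (hU.fderiv_of_isOpen ho (m := ∞) (by simp)).clm_apply contDiffOn_const
  refine h1.congr fun p hp => ?_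
  simp only [radialD]
  congr 1
  have hd : HasFDerivAt U (fderiv ℝ U p) p :=
    ((hU.differentiableOn (by simp)).differentiableAt (ho.mem_nhds hp)).hasFDerivAt
  have h2 := hd.comp_hasDerivAt p.2 ((hasDerivAt_const p.2 p.1).prodMk (hasDerivAt_id p.2))
  exact h2.deriv

theorem contDiffOn_iterate_radialD_uncurry {U : EuclideanSpace ℝ (Fin n) × ℝ → ℝ}
    (hU : ContDiffOn ℝ ∞ U (univ ×ˢ Ioi 0)) (j : ℕ) :
    ContDiffOn ℝ ∞
      (fun p : EuclideanSpace ℝ (Fin n) × ℝ => radialD^[j] (fun r => U (p.1, r)) p.2)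
      (univ ×ˢ Ioi 0) := by
  induction j with
  | zero => simpa using hU
  | succ j ih =>
    simp only [Function.iterate_succ_apply']
    exact contDiffOn_radialD_uncurry ih

theorem contDiffOn_filteredMean_uncurry (hf : ContDiff ℝ ∞ f) :
    ContDiffOn ℝ ∞ (fun p : EuclideanSpace ℝ (Fin n) × ℝ => filteredMean f p.1 p.2)
      (univ ×ˢ Ioi 0) :=
  contDiffOn_iterate_radialD_uncurry (U := fun p => p.2 ^ (n - 2) * sphericalMean f p.1 p.2)
    ((contDiff_snd.pow _).mul (contDiff_sphericalMean_uncurry hf)).contDiffOn _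

end

/-! ### Transfer of `D_r` to a test function of `r²`. -/

theorem contDiffOn_radialD {u : ℝ → ℝ} (hu : ContDiffOn ℝ ∞ u (Ioi 0)) :
    ContDiffOn ℝ ∞ (radialD u) (Ioi 0) := by
  refine ContDiffOn.mul ?_ (hu.deriv_of_isOpen isOpen_Ioi (m := ∞) (by simp))
  refine contDiffOn_const.div (by fun_prop) fun r (hr : 0 < r) => ?_
  positivity

/-- The weight `2 r` cancels the `1 / (2 r)` in `D_r`. The minus sign of the integration by parts
cancels the one from differentiating `ψ (t - r ^ 2)`, so no sign remains. The condition `ε < t`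
keeps the test function away from the singular point `r = 0`. -/
theorem integral_radialD_mul {u ψ ψ' : ℝ → ℝ} (hu : ContDiffOn ℝ ∞ u (Ioi 0))
    (hψ : ∀ s, HasDerivAt ψ (ψ' s) s) (hψ' : Continuous ψ') {ε t : ℝ} (hεt : ε < t)
    (hψ0 : ∀ s ∉ Ioo (-ε) ε, ψ s = 0) (hψ0' : ∀ s ∉ Ioo (-ε) ε, ψ' s = 0) :
    ∫ r in Ioi (0 : ℝ), radialD u r * (2 * r * ψ (t - r ^ 2)) =
      ∫ r in Ioi (0 : ℝ), u r * (2 * r * ψ' (t - r ^ 2)) := by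
  by_cases hε : 0 < ε
  swap
  · have h : Ioo (-ε) ε = ∅ := Ioo_eq_empty (by linarith)
    simp [hψ0, hψ0', h]
  set r₁ := √(t - ε) with hr₁
  set r₂ := √(t + ε) with hr₂
  have h₁ : 0 < r₁ := Real.sqrt_pos.2 (by linarith)
  have h₁₂ : r₁ ≤ r₂ := Real.sqrt_le_sqrt (by linarith)
  have hs₁ : r₁ ^ 2 = t - ε := Real.sq_sqrt (by linarith)
  have hs₂ : r₂ ^ 2 = t + ε := Real.sq_sqrt (by linarith)
  have key : ∀ (v χ : ℝ → ℝ), (∀ s ∉ Ioo (-ε) ε, χ s = 0) →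
      ∫ r in Ioi (0 : ℝ), v r * (2 * r * χ (t - r ^ 2)) =
        ∫ r in r₁..r₂, v r * (2 * r * χ (t - r ^ 2)) := by
    intro v χ hχ
    rw [intervalIntegral.integral_of_le h₁₂]
    refine setIntegral_eq_of_subset_of_forall_sdiff_eq_zero measurableSet_Ioi
      (fun r hr => h₁.trans hr.1) fun r hr => ?_
    rw [hχ, mul_zero, mul_zero]
    rintro ⟨h3, h4⟩
    refine hr.2 ⟨?_, ?_⟩
    · exact lt_of_pow_lt_pow_left₀ 2 (le_of_lt hr.1) (by linarith)
    · exact (lt_of_pow_lt_pow_left₀ 2 (h₁.le.trans h₁₂) (by linarith)).le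
  rw [key _ _ hψ0, key _ _ hψ0']
  have hpos : ∀ r ∈ uIcc r₁ r₂, 0 < r := fun r hr => by
    rw [uIcc_of_le h₁₂] at hr; exact h₁.trans_le hr.1
  have hd : ∀ r ∈ uIcc r₁ r₂, HasDerivAt u (deriv u r) r := fun r hr =>
    ((hu.differentiableOn (by simp)).differentiableAt (isOpen_Ioi.mem_nhds (hpos r hr))).hasDerivAt
  have hd' : ∀ r, HasDerivAt (fun r => ψ (t - r ^ 2)) (-(2 * r * ψ' (t - r ^ 2))) r := by
    intro r
    refine ((hψ (t - r ^ 2)).comp r (((hasDerivAt_id r).pow 2).const_sub t)).congr_deriv ?_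
    simp; ring
  have hdc : ContinuousOn (deriv u) (uIcc r₁ r₂) :=
    (hu.continuousOn_deriv_of_isOpen isOpen_Ioi (by simp)).mono hpos
  have := intervalIntegral.integral_mul_deriv_eq_deriv_mul_of_hasDerivAt (a := r₁) (b := r₂)
    (u := u) (v := fun r => ψ (t - r ^ 2))
    (fun r hr => (hd r hr).continuousAt.continuousWithinAt)
    (fun r _ => (hd' r).continuousAt.continuousWithinAt)
    (fun r hr => hd r (by exact Ioo_subset_Icc_self hr)) (fun r _ => hd' r)
    hdc.intervalIntegrable
    (Continuous.intervalIntegrable (by fun_prop) _ _)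
  simp only [hs₁, hs₂] at this
  -- At `r₁` and `r₂` the argument of `ψ` is `±ε`, an endpoint of the open interval, so the boundary
  -- terms vanish.
  rw [hψ0 (t - (t + ε)) (by simp), hψ0 (t - (t - ε)) (by simp)] at this
  simp only [mul_neg, intervalIntegral.integral_neg, mul_zero, sub_zero, zero_sub, neg_inj] at this
  rw [this]
  refine intervalIntegral.integral_congr fun r hr => ?_
  have := hpos r hr
  simp only [radialD]
  field_simp

theorem integral_iterate_radialD_mul {u φ : ℝ → ℝ} (hu : ContDiffOn ℝ ∞ u (Ioi 0))
    (hφ : ContDiff ℝ ∞ φ) {ε t : ℝ} (hεt : ε < t) (hε : tsupport φ ⊆ Ioo (-ε) ε) (j : ℕ) :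
    ∫ r in Ioi (0 : ℝ), radialD^[j] u r * (2 * r * φ (t - r ^ 2)) =
      ∫ r in Ioi (0 : ℝ), u r * (2 * r * iteratedDeriv j φ (t - r ^ 2)) := by
  have h0 : ∀ j, ∀ s ∉ Ioo (-ε) ε, iteratedDeriv j φ s = 0 := fun j s hs =>
    iteratedDeriv_eq_zero_of_notMem_tsupport j fun h => hs (hε h)
  induction j generalizing u with
  | zero => simp
  | succ j ih =>
    rw [Function.iterate_succ_apply, ih (contDiffOn_radialD hu)]
    exact integral_radialD_mul hu (hasDerivAt_iteratedDeriv_of_contDiff hφ j)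
      (continuous_iteratedDeriv_of_contDiff hφ _) hεt (h0 j) (h0 (j + 1))

/-! ### The fundamental solution of the Laplace equation. -/

section

variable {m : ℕ}

theorem locallyIntegrable_of_norm_le_inv_pow {K : EuclideanSpace ℝ (Fin (m + 3)) → ℝ} {j : ℕ}
    (hj : j ≤ m + 2) {C : ℝ} (hK : Measurable K) (hC : ∀ w, |K w| ≤ C * (‖w‖ ^ j)⁻¹) :
    LocallyIntegrable K := by
  refine locallyIntegrable_of_norm_le_rpow (C := C) (α := j) (by simp) ?_
    (Eventually.of_forall fun w => ?_) hK.aestronglyMeasurable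
  · simp; norm_cast; omega
  · rw [Real.rpow_neg (norm_nonneg _), Real.rpow_natCast]; exact hC w

theorem integrable_mul_inv_norm_pow {h : EuclideanSpace ℝ (Fin (m + 3)) → ℝ} (hc : Continuous h)
    (hs : HasCompactSupport h) {j : ℕ} (hj : j ≤ m + 2) :
    Integrable fun w => h w * (‖w‖ ^ j)⁻¹ := by
  have : LocallyIntegrable (fun w : EuclideanSpace ℝ (Fin (m + 3)) => (‖w‖ ^ j)⁻¹) :=
    locallyIntegrable_of_norm_le_inv_pow (C := 1) hj (by fun_prop)
      fun w => by rw [abs_of_nonneg (by positivity), one_mul]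
  exact this.integrable_smul_left_of_hasCompactSupport hc hs

theorem partialD_eq_fderiv {n : ℕ} {u : EuclideanSpace ℝ (Fin n) → ℝ} (hu : Differentiable ℝ u)
    (i : Fin n) : partialD i u = fun x => fderiv ℝ u x (EuclideanSpace.single i 1) :=
  funext fun x => (hu x).lineDeriv_eq_fderiv

theorem contDiff_partialD {n : ℕ} {u : EuclideanSpace ℝ (Fin n) → ℝ} (hu : ContDiff ℝ ∞ u)
    (i : Fin n) : ContDiff ℝ ∞ (partialD i u) := by
  rw [partialD_eq_fderiv (hu.differentiable (by simp))]
  exact (hu.fderiv_right (m := ∞) (by simp)).clm_apply contDiff_const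

theorem hasCompactSupport_partialD {n : ℕ} {u : EuclideanSpace ℝ (Fin n) → ℝ}
    (hu : ContDiff ℝ ∞ u) (hs : HasCompactSupport u) (i : Fin n) :
    HasCompactSupport (partialD i u) := by
  rw [partialD_eq_fderiv (hu.differentiable (by simp))]
  exact hs.fderiv_apply (𝕜 := ℝ) _

/-- The derivative of a regularized inverse power of the norm. -/
theorem hasFDerivAt_inv_sqrt_pow {n : ℕ} {ε : ℝ} (hε : 0 < ε) (j : ℕ)
    (w : EuclideanSpace ℝ (Fin n)) :
    HasFDerivAt (fun w : EuclideanSpace ℝ (Fin n) => (√(‖w‖ ^ 2 + ε) ^ j)⁻¹)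
      ((-(j * (√(‖w‖ ^ 2 + ε) ^ (j + 2))⁻¹)) • innerSL ℝ w) w := by
  have hq : 0 < ‖w‖ ^ 2 + ε := by positivity
  have hS : 0 < √(‖w‖ ^ 2 + ε) := Real.sqrt_pos.2 hq
  have h1 : HasFDerivAt (fun w : EuclideanSpace ℝ (Fin n) => ‖w‖ ^ 2 + ε)
      ((2 : ℝ) • innerSL ℝ w) w := by
    have := (hasStrictFDerivAt_norm_sq w).hasFDerivAt.add_const ε
    refine this.congr_fderiv ?_
    ext v; simp
  have h2 : HasDerivAt (fun q : ℝ => (√q ^ j)⁻¹)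
      (-(j * (√(‖w‖ ^ 2 + ε) ^ (j + 2))⁻¹) / 2) (‖w‖ ^ 2 + ε) := by
    have := ((Real.hasDerivAt_sqrt hq.ne').pow j).inv (pow_pos hS j).ne'
    refine this.congr_deriv ?_
    rcases j with _ | j
    · simp
    · simp only [Nat.add_sub_cancel, Pi.pow_apply]
      field_simp
      ring
  refine (h2.comp_hasFDerivAt w h1).congr_fderiv ?_
  rw [smul_smul]
  congr 1
  ring

theorem norm_le_sqrt_norm_sq_add {n : ℕ} {ε : ℝ} (hε : 0 ≤ ε) (w : EuclideanSpace ℝ (Fin n)) :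
    ‖w‖ ≤ √(‖w‖ ^ 2 + ε) :=
  Real.le_sqrt_of_sq_le (by linarith)

/-- Replacing `‖w‖` by `√(‖w‖² + ε)` makes the kernel smooth, so each coordinate can be integrated
by parts once; the terms `w i * partialD i g w` add up to the radial derivative. The remaining
derivative stays on `g`, so that the limit is again an absolutely convergent integral. -/
theorem integral_laplacian_mul_regularized {g : EuclideanSpace ℝ (Fin (m + 3)) → ℝ}
    (hg : ContDiff ℝ ∞ g) (hs : HasCompactSupport g) {ε : ℝ} (hε : 0 < ε) :
    ∫ w, (∑ i, partialD i (partialD i g) w) * (√(‖w‖ ^ 2 + ε) ^ (m + 1))⁻¹ =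
      (m + 1) * ∫ w, fderiv ℝ g w w * (√(‖w‖ ^ 2 + ε) ^ (m + 3))⁻¹ := by
  have hSc : Continuous fun w : EuclideanSpace ℝ (Fin (m + 3)) => √(‖w‖ ^ 2 + ε) := by fun_prop
  have hS : ∀ w : EuclideanSpace ℝ (Fin (m + 3)), √(‖w‖ ^ 2 + ε) ≠ 0 := fun w => by positivity
  have hΦ : ∀ j, Continuous fun w : EuclideanSpace ℝ (Fin (m + 3)) =>
      (√(‖w‖ ^ 2 + ε) ^ j)⁻¹ := fun j => (hSc.pow j).inv₀ fun w => pow_ne_zero _ (hS w)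
  have hint : ∀ {h k : EuclideanSpace ℝ (Fin (m + 3)) → ℝ}, Continuous h → HasCompactSupport h →
      Continuous k → Integrable fun w => k w * h w := fun h1 h2 h3 =>
    (h3.mul h1).integrable_of_hasCompactSupport h2.mul_left
  have hp1 : ∀ i, Continuous (partialD i g) := fun i => (contDiff_partialD hg i).continuous
  have hp2 : ∀ i, Continuous (partialD i (partialD i g)) := fun i =>
    (contDiff_partialD (contDiff_partialD hg i) i).continuous
  have hs1 : ∀ i, HasCompactSupport (partialD i g) := fun i => hasCompactSupport_partialD hg hs i
  have hs2 : ∀ i, HasCompactSupport (partialD i (partialD i g)) := fun i =>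
    hasCompactSupport_partialD (contDiff_partialD hg i) (hs1 i) i
  have hfd : ∀ (i) (w : EuclideanSpace ℝ (Fin (m + 3))),
      fderiv ℝ (fun w : EuclideanSpace ℝ (Fin (m + 3)) => (√(‖w‖ ^ 2 + ε) ^ (m + 1))⁻¹) w
        (EuclideanSpace.single i 1) = -(((m + 1 : ℕ) : ℝ) * (√(‖w‖ ^ 2 + ε) ^ (m + 3))⁻¹) * w i := by
    intro i w
    rw [(hasFDerivAt_inv_sqrt_pow hε (m + 1) w).fderiv]
    simp [EuclideanSpace.inner_single_right]
  have key : ∀ i, ∫ w, (√(‖w‖ ^ 2 + ε) ^ (m + 1))⁻¹ * partialD i (partialD i g) w =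
      ∫ w, ((m + 1 : ℕ) : ℝ) * ((w i * (√(‖w‖ ^ 2 + ε) ^ (m + 3))⁻¹) * partialD i g w) := by
    intro i
    have hdi : Differentiable ℝ (partialD i g) := (contDiff_partialD hg i).differentiable (by simp)
    have hwi : Continuous fun w : EuclideanSpace ℝ (Fin (m + 3)) => w i := by fun_prop
    have := integral_mul_fderiv_eq_neg_fderiv_mul_of_integrable (μ := volume)
      (f := fun w : EuclideanSpace ℝ (Fin (m + 3)) => (√(‖w‖ ^ 2 + ε) ^ (m + 1))⁻¹)
      (g := partialD i g) (v := EuclideanSpace.single i 1) ?_ ?_ ?_ ?_ ?_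
    · rw [partialD_eq_fderiv hdi, this, ← integral_neg]
      refine integral_congr_ae (Eventually.of_forall fun w => ?_)
      simp only [hfd]
      ring
    · simp only [hfd]
      exact hint (hp1 i) (hs1 i) ((continuous_const.mul (hΦ _)).neg.mul hwi)
    · have := hint (hp2 i) (hs2 i) (hΦ (m + 1))
      rwa [partialD_eq_fderiv hdi] at this
    · exact hint (hp1 i) (hs1 i) (hΦ (m + 1))
    · exact fun w _ => (hasFDerivAt_inv_sqrt_pow hε (m + 1) w).differentiableAt
    · exact fun w _ => hdi w
  have hwi : ∀ i, Continuous fun w : EuclideanSpace ℝ (Fin (m + 3)) => w i := by fun_prop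
  calc _ = ∫ w, ∑ i, (√(‖w‖ ^ 2 + ε) ^ (m + 1))⁻¹ * partialD i (partialD i g) w := by
        simp_rw [Finset.sum_mul, mul_comm]
    _ = ∑ i, ∫ w, ((m + 1 : ℕ) : ℝ) * ((w i * (√(‖w‖ ^ 2 + ε) ^ (m + 3))⁻¹) * partialD i g w) := by
        rw [integral_finsetSum _ fun i _ => hint (hp2 i) (hs2 i) (hΦ _)]
        exact Finset.sum_congr rfl fun i _ => key i
    _ = _ := by
        have hint1 : ∀ i, Integrable fun w => ((m + 1 : ℕ) : ℝ) *
            ((w i * (√(‖w‖ ^ 2 + ε) ^ (m + 3))⁻¹) * partialD i g w) := fun i =>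
          (hint (hp1 i) (hs1 i) ((hwi i).mul (hΦ (m + 3)))).const_mul _
        rw [← integral_finsetSum _ fun i _ => hint1 i, ← integral_const_mul]
        refine integral_congr_ae (Eventually.of_forall fun w => ?_)
        have hw : w = ∑ i, w i • EuclideanSpace.single i (1 : ℝ) := by
          ext j
          simp [Finset.sum_apply, Pi.single_apply]
        have hL : ∀ L : EuclideanSpace ℝ (Fin (m + 3)) →L[ℝ] ℝ,
            L w = ∑ i, w i * L (EuclideanSpace.single i 1) := by
          intro L
          conv_lhs => rw [hw, map_sum]
          simp only [map_smul, smul_eq_mul]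
        have hf : fderiv ℝ g w w = ∑ i, w i * partialD i g w := by
          simp only [partialD_eq_fderiv (hg.differentiable (by simp))]
          exact hL _
        simp only [hf, Finset.sum_mul, Finset.mul_sum]
        refine Finset.sum_congr rfl fun i _ => ?_
        push_cast; ring

/-- The regularized kernel is bounded by the singular one, which therefore serves as the dominating
function. -/
theorem tendsto_integral_mul_inv_sqrt_pow {h : EuclideanSpace ℝ (Fin (m + 3)) → ℝ}
    (hm : Continuous h) {j : ℕ} (hi : Integrable fun w => h w * (‖w‖ ^ j)⁻¹) :
    Tendsto (fun ε : ℝ => ∫ w, h w * (√(‖w‖ ^ 2 + ε) ^ j)⁻¹) (𝓝[>] 0)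
      (𝓝 (∫ w, h w * (‖w‖ ^ j)⁻¹)) := by
  refine tendsto_integral_filter_of_dominated_convergence (fun w => |h w * (‖w‖ ^ j)⁻¹|)
    (Eventually.of_forall fun ε => by fun_prop) ?_ hi.abs ?_
  · filter_upwards [self_mem_nhdsWithin] with ε (hε : 0 < ε)
    have : ∀ᵐ w : EuclideanSpace ℝ (Fin (m + 3)), w ≠ 0 := by simp [ae_iff]
    filter_upwards [this] with w hw
    have hwp := norm_pos_iff.2 hw
    rw [Real.norm_eq_abs, abs_mul, abs_mul]
    rw [abs_of_nonneg (by positivity : 0 ≤ (√(‖w‖ ^ 2 + ε) ^ j)⁻¹),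
      abs_of_nonneg (by positivity : 0 ≤ (‖w‖ ^ j)⁻¹)]
    gcongr
    exact norm_le_sqrt_norm_sq_add hε.le w
  · have : ∀ᵐ w : EuclideanSpace ℝ (Fin (m + 3)), w ≠ 0 := by simp [ae_iff]
    filter_upwards [this] with w hw
    have hwp := norm_pos_iff.2 hw
    have h1 : ContinuousAt (fun ε : ℝ => h w * (√(‖w‖ ^ 2 + ε) ^ j)⁻¹) 0 := by
      have : √(‖w‖ ^ 2 + 0) ^ j ≠ 0 := by positivity
      fun_prop (disch := assumption)
    have h2 := h1.tendsto
    simp only [add_zero, Real.sqrt_sq (norm_nonneg w)] at h2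
    exact h2.mono_left nhdsWithin_le_nhds

/-- The inverse power `‖w‖ ^ (2 - n)` is, up to a constant, the fundamental solution of the
Laplace equation in dimension `n = m + 3`. -/
theorem integral_laplacian_mul_inv_norm_pow {g : EuclideanSpace ℝ (Fin (m + 3)) → ℝ}
    (hg : ContDiff ℝ ∞ g) (hs : HasCompactSupport g) :
    ∫ w, (∑ i, partialD i (partialD i g) w) * (‖w‖ ^ (m + 1))⁻¹ =
      -((m + 1) * sphereArea (m + 2) * g 0) := by
  have hLc : Continuous fun w => ∑ i, partialD i (partialD i g) w :=
    continuous_finsetSum _ fun i _ => (contDiff_partialD (contDiff_partialD hg i) i).continuous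
  have hLi : Integrable fun w => (∑ i, partialD i (partialD i g) w) * (‖w‖ ^ (m + 1))⁻¹ := by
    simp_rw [Finset.sum_mul]
    exact integrable_finsetSum _ fun i _ => integrable_mul_inv_norm_pow
      (contDiff_partialD (contDiff_partialD hg i) i).continuous
      (hasCompactSupport_partialD (contDiff_partialD hg i) (hasCompactSupport_partialD hg hs i) i)
      (by omega)
  have hfc : Continuous (fderiv ℝ g) := hg.continuous_fderiv (by simp)
  have hDc : Continuous fun w => fderiv ℝ g w w := hfc.clm_apply continuous_id
  -- The power `m + 3` is not locally integrable in this dimension, but the factor `w` in the radial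
  -- derivative lowers it to `m + 2`.
  have hDi : Integrable fun w => fderiv ℝ g w w * (‖w‖ ^ (m + 3))⁻¹ := by
    refine (integrable_mul_inv_norm_pow (h := fun w => ‖fderiv ℝ g w‖) hfc.norm
      (hs.fderiv (𝕜 := ℝ)).norm le_rfl).mono'
      (hDc.measurable.mul (by fun_prop)).aestronglyMeasurable (Eventually.of_forall fun w => ?_)
    by_cases hw : w = 0
    · simp [hw]
    have hwp := norm_pos_iff.2 hw
    rw [norm_mul, norm_inv, norm_pow, norm_norm]
    calc ‖fderiv ℝ g w w‖ * (‖w‖ ^ (m + 3))⁻¹ ≤ (‖fderiv ℝ g w‖ * ‖w‖) * (‖w‖ ^ (m + 3))⁻¹ := by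
          gcongr; exact ContinuousLinearMap.le_opNorm _ _
      _ = _ := by rw [pow_succ ‖w‖ (m + 2)]; field_simp
  have h1 := tendsto_integral_mul_inv_sqrt_pow hLc hLi
  have h2 := (tendsto_integral_mul_inv_sqrt_pow hDc hDi).const_mul ((m : ℝ) + 1)
  have h3 := tendsto_nhds_unique (h1.congr' (by
    filter_upwards [self_mem_nhdsWithin] with ε hε
    exact integral_laplacian_mul_regularized hg hs hε)) h2
  rw [h3, integral_polar volume hDi]
  -- The volume factor `r^(m+2)` exactly cancels the kernel: the integrand is the derivative of `r ↦
  -- g (r σ)`, and `g` vanishes at infinity.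
  have hσ : ∀ σ : Metric.sphere (0 : EuclideanSpace ℝ (Fin (m + 3))) 1,
      (∫ r in Ioi (0 : ℝ), r ^ (finrank ℝ (EuclideanSpace ℝ (Fin (m + 3))) - 1) *
        (fderiv ℝ g (r • (σ : EuclideanSpace ℝ (Fin (m + 3)))) (r • σ) *
          (‖r • (σ : EuclideanSpace ℝ (Fin (m + 3)))‖ ^ (m + 3))⁻¹)) = - g 0 := by
    intro σ
    have hσ1 : ‖(σ : EuclideanSpace ℝ (Fin (m + 3)))‖ = 1 := by simp
    have hd : ∀ r : ℝ, HasDerivAt (fun r : ℝ => g (r • (σ : EuclideanSpace ℝ (Fin (m + 3)))))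
        (fderiv ℝ g (r • (σ : EuclideanSpace ℝ (Fin (m + 3)))) σ) r := by
      intro r
      have h := (hg.differentiable (by simp)
        (r • (σ : EuclideanSpace ℝ (Fin (m + 3))))).hasFDerivAt.comp_hasDerivAt r
        ((hasDerivAt_id r).smul_const (σ : EuclideanSpace ℝ (Fin (m + 3))))
      exact h.congr_deriv (by simp)
    have hemb : IsClosedEmbedding fun r : ℝ => r • (σ : EuclideanSpace ℝ (Fin (m + 3))) :=
      isClosedEmbedding_smul_left (by intro h; simp [h] at hσ1)
    have hcs : HasCompactSupport fun r : ℝ => g (r • (σ : EuclideanSpace ℝ (Fin (m + 3)))) :=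
      hs.comp_isClosedEmbedding hemb
    have hcs' : HasCompactSupport fun r : ℝ =>
        fderiv ℝ g (r • (σ : EuclideanSpace ℝ (Fin (m + 3)))) σ :=
      (hs.fderiv_apply (𝕜 := ℝ) (σ : EuclideanSpace ℝ (Fin (m + 3)))).comp_isClosedEmbedding hemb
    have h4 := integral_Ioi_of_hasDerivAt_of_tendsto' (a := 0) (m := 0) (fun r _ => hd r)
      (Continuous.integrable_of_hasCompactSupport (by fun_prop) hcs').integrableOn
      (hcs.is_zero_at_infty.mono_left (by rw [cocompact_eq_atBot_atTop]; exact le_sup_right))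
    rw [zero_smul, zero_sub] at h4
    rw [← h4]
    refine setIntegral_congr_fun measurableSet_Ioi fun r (hr : 0 < r) => ?_
    simp only [norm_smul, hσ1, mul_one, Real.norm_eq_abs, abs_of_pos hr, map_smul, smul_eq_mul,
      finrank_euclideanSpace_fin]
    rw [show m + 3 - 1 = m + 2 from rfl]
    field_simp
    ring
  simp_rw [hσ]
  rw [integral_const, sphereArea]
  simp; ring

end

/-! ### The linear change of variables `x ↦ A x`. -/

theorem diagMap_apply {n : ℕ} (a : Fin n → ℝ) (x : EuclideanSpace ℝ (Fin n)) (i : Fin n) :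
    diagMap a x i = a i * x i := by
  simp [diagMap, Matrix.toLpLin_apply, Matrix.mulVec_diagonal]

theorem diagMap_inv_diagMap {n : ℕ} {a : Fin n → ℝ} (ha : ∀ i, a i ≠ 0)
    (x : EuclideanSpace ℝ (Fin n)) : diagMap a⁻¹ (diagMap a x) = x := by
  ext i; simp [diagMap_apply, ha i]

theorem diagMap_diagMap_inv {n : ℕ} {a : Fin n → ℝ} (ha : ∀ i, a i ≠ 0)
    (x : EuclideanSpace ℝ (Fin n)) : diagMap a (diagMap a⁻¹ x) = x := by
  ext i; simp [diagMap_apply, ha i]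

theorem continuous_diagMap {n : ℕ} (a : Fin n → ℝ) : Continuous (diagMap a) :=
  LinearMap.continuous_of_finiteDimensional _

theorem contDiff_diagMap {n : ℕ} (a : Fin n → ℝ) : ContDiff ℝ ∞ (diagMap a) :=
  (LinearMap.toContinuousLinearMap (diagMap a)).contDiff

theorem det_diagMap {n : ℕ} (a : Fin n → ℝ) :
    LinearMap.det (diagMap a) = (Matrix.diagonal a).det := by
  rw [diagMap, Matrix.toEuclideanLin_eq_toLin_orthonormal, LinearMap.det_toLin]

theorem exists_norm_le_mul_norm_diagMap {n : ℕ} {a : Fin n → ℝ} (ha : ∀ i, a i ≠ 0) :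
    ∃ c : ℝ, 0 ≤ c ∧ ∀ x, ‖x‖ ≤ c * ‖diagMap a x‖ := by
  refine ⟨‖LinearMap.toContinuousLinearMap (diagMap a⁻¹)‖, norm_nonneg _, fun x => ?_⟩
  conv_lhs => rw [← diagMap_inv_diagMap ha x]
  exact (LinearMap.toContinuousLinearMap (diagMap a⁻¹)).le_opNorm (diagMap a x)

theorem integral_comp_diagMap {n : ℕ} {a : Fin n → ℝ} (ha : ∀ i, 0 < a i)
    {G : EuclideanSpace ℝ (Fin n) → ℝ} (hG : Measurable G) :
    ∫ x, G (diagMap a x) = (Matrix.diagonal a).det⁻¹ * ∫ x, G x := by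
  have hdet : 0 < (Matrix.diagonal a).det := by
    rw [Matrix.det_diagonal]; exact Finset.prod_pos fun i _ => ha i
  have h := Measure.map_linearMap_addHaar_eq_smul_addHaar
    (volume : Measure (EuclideanSpace ℝ (Fin n))) (f := diagMap a)
    (by rw [det_diagMap]; exact hdet.ne')
  rw [← integral_map (continuous_diagMap a).measurable.aemeasurable hG.aestronglyMeasurable, h,
    integral_smul_measure, det_diagMap, abs_of_pos (inv_pos.2 hdet),
    ENNReal.toReal_ofReal (inv_pos.2 hdet).le, smul_eq_mul]

theorem partialD_comp_diagMap {n : ℕ} (a : Fin n → ℝ) {u : EuclideanSpace ℝ (Fin n) → ℝ}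
    (hu : Differentiable ℝ u) (x : EuclideanSpace ℝ (Fin n)) (i : Fin n) :
    partialD i (fun w => u (x + diagMap a w)) =
      fun w => a i * partialD i u (x + diagMap a w) := by
  have hd : ∀ w, HasFDerivAt (fun w => u (x + diagMap a w))
      ((fderiv ℝ u (x + diagMap a w)).comp (LinearMap.toContinuousLinearMap (diagMap a))) w :=
    fun w => (hu _).hasFDerivAt.comp w
      ((LinearMap.toContinuousLinearMap (diagMap a)).hasFDerivAt.const_add x)
  rw [partialD_eq_fderiv hu, partialD_eq_fderiv fun w => (hd w).differentiableAt]
  funext w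
  rw [(hd w).fderiv]
  have : diagMap a (EuclideanSpace.single i 1) = a i • EuclideanSpace.single i (1 : ℝ) := by
    ext j
    by_cases h : j = i
    · subst h; simp [diagMap_apply]
    · simp [diagMap_apply, h]
  simp [this]

/-! ### The Newtonian potential in the coordinates `A x`. -/

section

variable {m : ℕ}

/-- The Newtonian potential of `f` with respect to the linear coordinates `A x`. -/
noncomputable def diagPotential (a : Fin (m + 3) → ℝ) (f : EuclideanSpace ℝ (Fin (m + 3)) → ℝ)
    (x : EuclideanSpace ℝ (Fin (m + 3))) : ℝ :=
  ∫ y, f y * (‖diagMap a (y - x)‖ ^ (m + 1))⁻¹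

variable {a : Fin (m + 3) → ℝ} {f : EuclideanSpace ℝ (Fin (m + 3)) → ℝ}

theorem exists_inv_norm_diagMap_pow_le (ha : ∀ i, a i ≠ 0) :
    ∃ C : ℝ, 0 ≤ C ∧ ∀ x, (‖diagMap a x‖ ^ (m + 1))⁻¹ ≤ C * (‖x‖ ^ (m + 1))⁻¹ := by
  obtain ⟨c, hc, h⟩ := exists_norm_le_mul_norm_diagMap ha
  refine ⟨c ^ (m + 1), by positivity, fun x => ?_⟩
  -- At the origin both sides are zero, as `0⁻¹ = 0`.
  by_cases hx : x = 0
  · simp [hx]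
  have hxp := norm_pos_iff.2 hx
  have hA : 0 < ‖diagMap a x‖ := by
    by_contra h0
    have := h x
    nlinarith [norm_nonneg (diagMap a x)]
  rw [← div_eq_mul_inv, inv_le_comm₀ (by positivity) (by
    have : 0 < c := by
      by_contra h0
      have := h x
      nlinarith
    positivity), inv_div, div_le_iff₀' (by
    have : 0 < c := by
      by_contra h0
      have := h x
      nlinarith
    positivity), ← mul_pow]
  exact pow_le_pow_left₀ (norm_nonneg _) (h x) _

theorem measurable_inv_norm_diagMap_pow (a : Fin (m + 3) → ℝ) :
    Measurable fun x => (‖diagMap a x‖ ^ (m + 1))⁻¹ :=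
  ((continuous_diagMap a).norm.measurable.pow_const _).inv

theorem locallyIntegrable_inv_norm_diagMap_pow (ha : ∀ i, a i ≠ 0) :
    LocallyIntegrable fun x => (‖diagMap a x‖ ^ (m + 1))⁻¹ := by
  obtain ⟨C, -, hC⟩ := exists_inv_norm_diagMap_pow_le ha
  refine locallyIntegrable_of_norm_le_inv_pow (C := C) (j := m + 1) (by omega)
    (measurable_inv_norm_diagMap_pow a) fun x => ?_
  rw [abs_of_nonneg (by positivity)]
  exact hC x

/-- The kernel is even. As a convolution with a locally integrable kernel, the potential inherits
the smoothness of `f`, and its derivatives fall on `f`. -/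
theorem diagPotential_eq_convolution (a : Fin (m + 3) → ℝ)
    (f : EuclideanSpace ℝ (Fin (m + 3)) → ℝ) :
    diagPotential a f =
      (fun x => (‖diagMap a x‖ ^ (m + 1))⁻¹) ⋆[ContinuousLinearMap.mul ℝ ℝ, volume] f := by
  funext x
  rw [convolution_def, diagPotential, ← integral_sub_left_eq_self _ volume x]
  refine integral_congr_ae (Eventually.of_forall fun t => ?_)
  simp only [sub_sub_cancel_left, map_neg, norm_neg, ContinuousLinearMap.mul_apply']
  ring

theorem contDiff_diagPotential (ha : ∀ i, a i ≠ 0) (hf : ContDiff ℝ ∞ f)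
    (hs : HasCompactSupport f) : ContDiff ℝ ∞ (diagPotential a f) := by
  rw [diagPotential_eq_convolution]
  exact hs.contDiff_convolution_right _ (locallyIntegrable_inv_norm_diagMap_pow ha) hf

theorem partialD_diagPotential (ha : ∀ i, a i ≠ 0) (hf : ContDiff ℝ ∞ f)
    (hs : HasCompactSupport f) (i : Fin (m + 3)) :
    partialD i (diagPotential a f) = diagPotential a (partialD i f) := by
  rw [partialD_eq_fderiv ((contDiff_diagPotential ha hf hs).differentiable (by simp)),
    partialD_eq_fderiv (hf.differentiable (by simp)), diagPotential_eq_convolution,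
    diagPotential_eq_convolution]
  funext x
  have hK := locallyIntegrable_inv_norm_diagMap_pow ha
  rw [(hs.hasFDerivAt_convolution_right _ hK (hf.of_le (by simp)) x).fderiv,
    convolution_precompR_apply _ hK (hs.fderiv (𝕜 := ℝ)) (hf.continuous_fderiv (by simp))]

/-- With both derivatives on `f`, the substitution `w = A(y - x)` turns `a_i⁻² ∂_i²` into `∂²/∂w_i²`
acting on `f (x + A⁻¹ w)`. The Euclidean case at `w = 0` applies, and the Jacobian gives the inverse
determinant. -/
theorem laplacianDiag_diagPotential (ha : ∀ i, 0 < a i) (hf : ContDiff ℝ ∞ f)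
    (hs : HasCompactSupport f) (x : EuclideanSpace ℝ (Fin (m + 3))) :
    laplacianDiag a (diagPotential a f) x =
      -((m + 1) * sphereArea (m + 2) * (Matrix.diagonal a).det⁻¹ * f x) := by
  have ha0 : ∀ i, a i ≠ 0 := fun i => (ha i).ne'
  let g : EuclideanSpace ℝ (Fin (m + 3)) → ℝ := fun w => f (x + diagMap a⁻¹ w)
  have hg : ContDiff ℝ ∞ g := hf.comp (contDiff_const.add (contDiff_diagMap _))
  have hgs : HasCompactSupport g := by
    let e : EuclideanSpace ℝ (Fin (m + 3)) ≃ₜ EuclideanSpace ℝ (Fin (m + 3)) :=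
      { toFun := fun w => x + diagMap a⁻¹ w
        invFun := fun y => diagMap a (y - x)
        left_inv := fun w => by simp [diagMap_diagMap_inv ha0]
        right_inv := fun y => by simp [diagMap_inv_diagMap ha0]
        continuous_toFun := continuous_const.add (continuous_diagMap _)
        continuous_invFun := (continuous_diagMap _).comp (continuous_id.sub continuous_const) }
    exact hs.comp_homeomorph e
  have hp := fun i => contDiff_partialD hf i
  have hps := fun i => hasCompactSupport_partialD hf hs i
  have hpp := fun i => contDiff_partialD (hp i) i
  have hpps := fun i => hasCompactSupport_partialD (hp i) (hps i) i
  have hgg : ∀ i w, partialD i (partialD i g) w =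
      1 / a i ^ 2 * partialD i (partialD i f) (x + diagMap a⁻¹ w) := by
    intro i w
    have h1 := partialD_comp_diagMap a⁻¹ (hf.differentiable (by simp)) x i
    have h2 := partialD_comp_diagMap a⁻¹ ((hp i).differentiable (by simp)) x i
    have h3 : Differentiable ℝ fun w => partialD i f (x + diagMap a⁻¹ w) :=
      ((hp i).comp (contDiff_const.add (contDiff_diagMap _))).differentiable (by simp)
    simp only [g]
    rw [h1]
    have h4 : partialD i (fun w => (a⁻¹) i * partialD i f (x + diagMap a⁻¹ w)) w =
        (a⁻¹) i * partialD i (fun w => partialD i f (x + diagMap a⁻¹ w)) w := by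
      rw [partialD_eq_fderiv h3, partialD_eq_fderiv (h3.const_mul _)]
      beta_reduce
      rw [fderiv_const_mul (h3 w)]
      simp
    rw [h4, h2]
    simp only [Pi.inv_apply]
    ring
  have key := integral_laplacian_mul_inv_norm_pow hg hgs
  have hLm : Measurable fun w => (∑ i, partialD i (partialD i g) w) * (‖w‖ ^ (m + 1))⁻¹ := by
    refine Measurable.mul ?_ (by fun_prop)
    exact (continuous_finsetSum _ fun i _ =>
      (contDiff_partialD (contDiff_partialD hg i) i).continuous).measurable
  have hcv := integral_comp_diagMap ha hLm
  rw [key] at hcv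
  simp only [hgg, diagMap_inv_diagMap ha0] at hcv
  have hint : ∀ i, Integrable fun y =>
      1 / a i ^ 2 * (partialD i (partialD i f) (x + y) * (‖diagMap a y‖ ^ (m + 1))⁻¹) := by
    intro i
    refine Integrable.const_mul ?_ _
    exact (locallyIntegrable_inv_norm_diagMap_pow ha0).integrable_smul_left_of_hasCompactSupport
      ((hpp i).continuous.comp (by fun_prop))
      ((hpps i).comp_homeomorph (Homeomorph.addLeft x))
  have hlap : laplacianDiag a (diagPotential a f) x =
      ∫ y, (∑ i, 1 / a i ^ 2 * partialD i (partialD i f) (x + y)) *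
        (‖diagMap a y‖ ^ (m + 1))⁻¹ := by
    simp_rw [Finset.sum_mul, mul_assoc]
    rw [integral_finsetSum _ fun i _ => hint i, laplacianDiag]
    refine Finset.sum_congr rfl fun i _ => ?_
    rw [partialD_diagPotential ha0 hf hs, partialD_diagPotential ha0 (hp i) (hps i),
      integral_const_mul, diagPotential, ← integral_add_left_eq_self _ x]
    simp
  rw [hlap, hcv]
  simp [g]
  ring

end

/-! ### The ellipsoid as the image of the unit ball under `A`. -/

theorem norm_diagMap_inv_sq {n : ℕ} (a : Fin n → ℝ) (x : EuclideanSpace ℝ (Fin n)) :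
    ‖diagMap a⁻¹ x‖ ^ 2 = ∑ i, x i ^ 2 / a i ^ 2 := by
  rw [EuclideanSpace.norm_sq_eq]
  refine Finset.sum_congr rfl fun i _ => ?_
  rw [diagMap_apply, Real.norm_eq_abs, sq_abs, Pi.inv_apply]
  ring

theorem mem_solidEllipsoid_iff {n : ℕ} {a : Fin n → ℝ} {x : EuclideanSpace ℝ (Fin n)} :
    x ∈ solidEllipsoid a ↔ ‖diagMap a⁻¹ x‖ < 1 := by
  rw [solidEllipsoid, mem_ofPred_eq, ← norm_diagMap_inv_sq]
  exact sq_lt_one_iff₀ (norm_nonneg _)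

theorem isOpen_solidEllipsoid {n : ℕ} (a : Fin n → ℝ) : IsOpen (solidEllipsoid a) := by
  have : solidEllipsoid a = {x | ‖diagMap a⁻¹ x‖ < 1} := by ext; exact mem_solidEllipsoid_iff
  rw [this]
  exact isOpen_lt (continuous_diagMap _).norm continuous_const

theorem norm_diagMap_inv_le_one_of_mem_closure {n : ℕ} {a : Fin n → ℝ}
    {x : EuclideanSpace ℝ (Fin n)} (hx : x ∈ closure (solidEllipsoid a)) :
    ‖diagMap a⁻¹ x‖ ≤ 1 :=
  closure_minimal (t := {x | ‖diagMap a⁻¹ x‖ ≤ 1})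
    (fun _ hy => (mem_solidEllipsoid_iff.1 hy).le)
    (isClosed_le (continuous_diagMap _).norm continuous_const) hx

theorem isCompact_closure_solidEllipsoid {n : ℕ} {a : Fin n → ℝ} (ha : ∀ i, a i ≠ 0) :
    IsCompact (closure (solidEllipsoid a)) := by
  refine Metric.isCompact_of_isClosed_isBounded isClosed_closure
    ((Metric.isBounded_closedBall
      (x := 0) (r := ‖LinearMap.toContinuousLinearMap (diagMap a)‖)).subset fun x hx => ?_)
  rw [mem_closedBall_zero_iff]
  have h1 := (LinearMap.toContinuousLinearMap (diagMap a)).le_opNorm (diagMap a⁻¹ x)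
  have h2 : LinearMap.toContinuousLinearMap (diagMap a) (diagMap a⁻¹ x) = x :=
    diagMap_diagMap_inv ha x
  rw [h2] at h1
  exact h1.trans (mul_le_of_le_one_right (norm_nonneg _) (norm_diagMap_inv_le_one_of_mem_closure hx))

/-- `A σ` has `‖A⁻¹ A σ‖ = 1`, hence lies outside the open ellipsoid; the radius zero is never
evaluated. -/
theorem diagMap_sphere_ne {n : ℕ} {a : Fin n → ℝ} (ha : ∀ i, a i ≠ 0)
    {x : EuclideanSpace ℝ (Fin n)} (hx : x ∈ solidEllipsoid a)
    (σ : Metric.sphere (0 : EuclideanSpace ℝ (Fin n)) 1) : 0 < ‖x - diagMap a σ‖ := by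
  rw [norm_pos_iff, sub_ne_zero]
  rintro rfl
  have h := mem_solidEllipsoid_iff.1 hx
  rw [diagMap_inv_diagMap ha] at h
  simp at h

theorem continuous_filteredMean_sphere {n : ℕ} {a : Fin n → ℝ} (ha : ∀ i, a i ≠ 0)
    {f : EuclideanSpace ℝ (Fin n) → ℝ} (hf : ContDiff ℝ ∞ f)
    {x : EuclideanSpace ℝ (Fin n)} (hx : x ∈ solidEllipsoid a) :
    Continuous fun σ : Metric.sphere (0 : EuclideanSpace ℝ (Fin n)) 1 =>
      filteredMean f (diagMap a σ) ‖x - diagMap a σ‖ := by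
  have hc : Continuous fun σ : Metric.sphere (0 : EuclideanSpace ℝ (Fin n)) 1 =>
      (diagMap a σ, ‖x - diagMap a σ‖) := by
    have := (continuous_diagMap a).comp (continuous_subtype_val
      (p := fun y => y ∈ Metric.sphere (0 : EuclideanSpace ℝ (Fin n)) 1))
    exact this.prodMk (continuous_const.sub this).norm
  exact (contDiffOn_filteredMean_uncurry hf).continuousOn.comp_continuous hc
    fun σ => ⟨mem_univ _, diagMap_sphere_ne ha hx σ⟩

theorem inner_diagMap_left {n : ℕ} (a : Fin n → ℝ) (x y : EuclideanSpace ℝ (Fin n)) :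
    inner ℝ (diagMap a x) y = inner ℝ x (diagMap a y) := by
  simp only [PiLp.inner_apply, diagMap_apply, RCLike.inner_apply, conj_trivial]
  exact Finset.sum_congr rfl fun i _ => by ring

/-! ### Spherical means as volume integrals, and exchange of integrals. -/

/-- The product of `r^(n-2)` and `2 r` is twice the polar volume factor `r^(n-1)`, so polar
coordinates around `z` apply. -/
theorem integral_sphericalMean_mul {m : ℕ} {f : EuclideanSpace ℝ (Fin (m + 3)) → ℝ}
    (hf : Continuous f) (hs : HasCompactSupport f)
    {ψ : ℝ → ℝ} (hψ : Continuous ψ) (z : EuclideanSpace ℝ (Fin (m + 3))) (t : ℝ) :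
    ∫ r in Ioi (0 : ℝ), (r ^ (m + 1) * sphericalMean f z r) * (2 * r * ψ (t - r ^ 2)) =
      2 / sphereArea (m + 2) * ∫ y, f y * ψ (t - ‖y - z‖ ^ 2) := by
  have hi : Integrable fun v => f (z + v) * ψ (t - ‖v‖ ^ 2) :=
    Continuous.integrable_of_hasCompactSupport (by fun_prop)
      (HasCompactSupport.mul_right (hs.comp_homeomorph (Homeomorph.addLeft z)))
  have h1 := integral_polar_radial volume hi
  rw [← integral_add_left_eq_self _ z]
  simp only [add_sub_cancel_left]
  rw [h1, ← integral_const_mul]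
  refine setIntegral_congr_fun measurableSet_Ioi fun r (hr : 0 < r) => ?_
  have h2 : ∀ σ : Metric.sphere (0 : EuclideanSpace ℝ (Fin (m + 3))) 1,
      ‖r • (σ : EuclideanSpace ℝ (Fin (m + 3)))‖ = r := by
    intro σ; simp [norm_smul, abs_of_pos hr]
  simp only [h2, finrank_euclideanSpace_fin, sphericalMean]
  rw [integral_mul_const, show m + 3 - 1 = m + 2 from rfl]
  ring

/-- Besides Fubini, this uses that `‖A σ‖²` cancels in the difference of squares, which makes the
argument of `ψ` affine in `σ`. -/
theorem integral_sphere_integral_swap {n : ℕ} (a : Fin n → ℝ)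
    {f : EuclideanSpace ℝ (Fin n) → ℝ} (hf : Continuous f)
    (hs : HasCompactSupport f) {ψ : ℝ → ℝ} (hψ : Continuous ψ)
    (x : EuclideanSpace ℝ (Fin n)) :
    ∫ σ : Metric.sphere (0 : EuclideanSpace ℝ (Fin n)) 1,
        (∫ y, f y * ψ (‖x - diagMap a σ‖ ^ 2 - ‖y - diagMap a σ‖ ^ 2))
          ∂(volume : Measure (EuclideanSpace ℝ (Fin n))).toSphere =
      ∫ y, f y * ∫ σ : Metric.sphere (0 : EuclideanSpace ℝ (Fin n)) 1,
        ψ (2 * inner ℝ (diagMap a (y - x)) (σ : EuclideanSpace ℝ (Fin n)) -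
          (‖y‖ ^ 2 - ‖x‖ ^ 2)) ∂(volume : Measure (EuclideanSpace ℝ (Fin n))).toSphere := by
  have hA := (continuous_diagMap a).comp (continuous_subtype_val
      (p := fun y => y ∈ Metric.sphere (0 : EuclideanSpace ℝ (Fin n)) 1))
  have hA' : Continuous fun σ : Metric.sphere (0 : EuclideanSpace ℝ (Fin n)) 1 =>
    diagMap a σ := hA
  rw [integral_integral_swap]
  · refine integral_congr_ae (Eventually.of_forall fun y => ?_)
    simp only
    rw [integral_const_mul]
    congr 1
    refine integral_congr_ae (Eventually.of_forall fun σ => ?_)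
    simp only
    congr 1
    rw [norm_sub_sq_real, norm_sub_sq_real, inner_diagMap_left, inner_sub_left]
    ring
  · refine Continuous.integrable_of_hasCompactSupport ?_ ?_
    · change Continuous fun q : Metric.sphere (0 : EuclideanSpace ℝ (Fin n)) 1 ×
        EuclideanSpace ℝ (Fin n) =>
          f q.2 * ψ (‖x - diagMap a q.1‖ ^ 2 - ‖q.2 - diagMap a q.1‖ ^ 2)
      have h1 := hA'.comp (continuous_fst (X := Metric.sphere (0 : EuclideanSpace ℝ (Fin n)) 1)
        (Y := EuclideanSpace ℝ (Fin n)))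
      simp only [Function.comp_def] at h1
      fun_prop
    · refine HasCompactSupport.intro (isCompact_univ.prod hs.isCompact) fun q hq => ?_
      have : q.2 ∉ tsupport f := fun h => hq ⟨mem_univ _, h⟩
      simp [Function.uncurry, image_eq_zero_of_notMem_tsupport this]

/-! ### Mollification in the squared radius. -/

/-- The rescaled bump function `s ↦ ε⁻¹ φ (ε⁻¹ s)`. -/
noncomputable def mollifier (φ : ℝ → ℝ) (ε : ℝ) : ℝ → ℝ := fun s => ε⁻¹ * φ (ε⁻¹ * s)

theorem exists_smooth_bump : ∃ φ : ℝ → ℝ, ContDiff ℝ ∞ φ ∧ tsupport φ ⊆ Ioo (-1) 1 ∧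
    ∫ s, φ s = 1 := by
  let b : ContDiffBump (0 : ℝ) := ⟨1 / 4, 1 / 2, by norm_num, by norm_num⟩
  refine ⟨b.normed volume, b.contDiff_normed, ?_, b.integral_normed⟩
  rw [b.tsupport_normed_eq, Real.closedBall_eq_Icc]
  intro s hs
  simp only [b, mem_Icc] at hs
  constructor <;> linarith [hs.1, hs.2]

section Mollifier

variable {φ : ℝ → ℝ} {ε : ℝ}

theorem contDiff_mollifier (hφ : ContDiff ℝ ∞ φ) : ContDiff ℝ ∞ (mollifier φ ε) :=
  contDiff_const.mul (hφ.comp (contDiff_const.mul contDiff_id))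

theorem tsupport_mollifier_subset (hε : 0 < ε) (h : tsupport φ ⊆ Ioo (-1) 1) :
    tsupport (mollifier φ ε) ⊆ Ioo (-ε) ε := by
  have hc : IsClosed ((fun s => ε⁻¹ * s) ⁻¹' tsupport φ) :=
    (isClosed_tsupport φ).preimage (by fun_prop)
  refine (closure_minimal (fun s hs => ?_) hc).trans fun s hs => ?_
  · exact subset_tsupport φ fun h0 => hs (by simp [mollifier, h0])
  · have := h hs
    rw [mem_Ioo, inv_mul_lt_iff₀ hε, ← neg_lt_neg_iff, neg_neg, ← mul_neg, inv_mul_lt_iff₀ hε] at this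
    constructor <;> linarith [this.1, this.2]

theorem integral_mollifier (hε : 0 < ε) : ∫ s, mollifier φ ε s = ∫ s, φ s := by
  simp only [mollifier]
  rw [integral_const_mul, Measure.integral_comp_mul_left φ, inv_inv, abs_of_pos hε, smul_eq_mul,
    inv_mul_cancel_left₀ hε.ne']

theorem iteratedDeriv_mollifier (hφ : ContDiff ℝ ∞ φ) (j : ℕ) (s : ℝ) :
    iteratedDeriv j (mollifier φ ε) s = ε⁻¹ ^ (j + 1) * iteratedDeriv j φ (ε⁻¹ * s) := by
  have h1 : ContDiff ℝ j φ := hφ.of_le (mod_cast le_top)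
  have h2 := congrFun (iteratedDeriv_comp_const_mul h1 ε⁻¹) s
  unfold mollifier
  rw [iteratedDeriv_const_mul_field, h2]
  ring

end Mollifier

/-- The substitutions `s = r²` and `s = t - ε v` move `ε` from the mollifier into the argument of
`F`, so that the limit `ε → 0` becomes a matter of continuity. -/
theorem integral_Ioi_mul_mollifier {φ : ℝ → ℝ} (hφ : tsupport φ ⊆ Ioo (-1) 1) {ε t : ℝ}
    (hε : 0 < ε) (hεt : ε < t) (F : ℝ → ℝ) :
    ∫ r in Ioi (0 : ℝ), F r * (2 * r * mollifier φ ε (t - r ^ 2)) =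
      ∫ v in Icc (-1 : ℝ) 1, F √(t - ε * v) * φ v := by
  have h1 := integral_comp_rpow_Ioi_of_pos (g := fun s => F √s * mollifier φ ε (t - s)) two_pos
  have h2 : ∫ r in Ioi (0 : ℝ), F r * (2 * r * mollifier φ ε (t - r ^ 2)) =
      ∫ s in Ioi (0 : ℝ), F √s * mollifier φ ε (t - s) := by
    rw [← h1]
    refine setIntegral_congr_fun measurableSet_Ioi fun r (hr : 0 < r) => ?_
    simp only [Real.rpow_two, Real.sqrt_sq hr.le, smul_eq_mul]
    rw [show (2 : ℝ) - 1 = 1 by norm_num, Real.rpow_one]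
    ring
  have h3 : ∫ s in Ioi (0 : ℝ), F √s * mollifier φ ε (t - s) =
      ∫ s, F √s * mollifier φ ε (t - s) := by
    refine setIntegral_eq_integral_of_forall_compl_eq_zero fun s hs => ?_
    have hs' : s ≤ 0 := not_lt.1 hs
    rw [image_eq_zero_of_notMem_tsupport (f := mollifier φ ε), mul_zero]
    intro h
    have := (tsupport_mollifier_subset hε hφ h).2
    linarith
  have h4 := Measure.integral_comp_mul_left (fun v => F √(t - ε * v) * φ v) ε⁻¹
  rw [h2, h3, ← integral_sub_left_eq_self _ volume t]
  have h5 : ∀ s, F √(t - s) * mollifier φ ε (t - (t - s)) =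
      ε⁻¹ * (F √(t - ε * (ε⁻¹ * s)) * φ (ε⁻¹ * s)) := by
    intro s
    rw [mul_inv_cancel_left₀ hε.ne', sub_sub_cancel, mollifier]
    ring
  simp_rw [h5]
  rw [integral_const_mul, h4, inv_inv, abs_of_pos hε, smul_eq_mul, inv_mul_cancel_left₀ hε.ne']
  refine (setIntegral_eq_integral_of_forall_compl_eq_zero fun v hv => ?_).symm
  rw [image_eq_zero_of_notMem_tsupport (f := φ), mul_zero]
  exact fun h => hv (Ioo_subset_Icc_self (hφ h))

theorem exists_lt_norm_sub_diagMap_sphere_sq {n : ℕ} {a : Fin n → ℝ} (ha : ∀ i, a i ≠ 0)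
    {x : EuclideanSpace ℝ (Fin n)} (hx : x ∈ solidEllipsoid a) :
    ∃ τ : ℝ, 0 < τ ∧ ∀ σ : Metric.sphere (0 : EuclideanSpace ℝ (Fin n)) 1,
      τ < ‖x - diagMap a σ‖ ^ 2 := by
  rcases isEmpty_or_nonempty (Metric.sphere (0 : EuclideanSpace ℝ (Fin n)) 1) with he | hne
  · exact ⟨1, one_pos, fun σ => (he.false σ).elim⟩
  have hc : Continuous fun σ : Metric.sphere (0 : EuclideanSpace ℝ (Fin n)) 1 =>
      ‖x - diagMap a σ‖ ^ 2 :=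
    ((continuous_const.sub ((continuous_diagMap a).comp continuous_subtype_val)).norm).pow 2
  obtain ⟨σ₀, -, h⟩ := isCompact_univ.exists_isMinOn univ_nonempty hc.continuousOn
  have hp : 0 < ‖x - diagMap a σ₀‖ ^ 2 := pow_pos (diagMap_sphere_ne ha hx σ₀) 2
  exact ⟨‖x - diagMap a σ₀‖ ^ 2 / 2, half_pos hp, fun σ =>
    (half_lt_self hp).trans_le (h (mem_univ σ))⟩

theorem tendsto_integral_filteredMean_mollifier {n : ℕ} {a : Fin n → ℝ} (ha : ∀ i, a i ≠ 0)
    {f : EuclideanSpace ℝ (Fin n) → ℝ} (hf : ContDiff ℝ ∞ f)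
    {x : EuclideanSpace ℝ (Fin n)} (hx : x ∈ solidEllipsoid a)
    {φ : ℝ → ℝ} (hφc : Continuous φ) (hφ : tsupport φ ⊆ Ioo (-1) 1) (hφ1 : ∫ s, φ s = 1) :
    Tendsto (fun ε => ∫ σ : Metric.sphere (0 : EuclideanSpace ℝ (Fin n)) 1,
        (∫ r in Ioi (0 : ℝ), filteredMean f (diagMap a σ) r *
          (2 * r * mollifier φ ε (‖x - diagMap a σ‖ ^ 2 - r ^ 2)))
          ∂(volume : Measure (EuclideanSpace ℝ (Fin n))).toSphere)
      (𝓝[>] 0) (𝓝 (backProjection a f x)) := by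
  obtain ⟨τ, hτ, hτx⟩ := exists_lt_norm_sub_diagMap_sphere_sq ha hx
  -- The maximum keeps the radius positive for every real `ε`, which makes `G` continuous
  -- everywhere, including at `ε = 0`. It is inactive for `0 < ε < τ / 2` and `v ≤ 1`, since `‖x - A
  -- σ‖² > τ`.
  let G : (ℝ × Metric.sphere (0 : EuclideanSpace ℝ (Fin n)) 1) → ℝ → ℝ := fun q v =>
    filteredMean f (diagMap a q.2) √(max (‖x - diagMap a q.2‖ ^ 2 - q.1 * v) (τ / 2)) * φ v
  have hA : Continuous fun σ : Metric.sphere (0 : EuclideanSpace ℝ (Fin n)) 1 =>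
    diagMap a σ := (continuous_diagMap a).comp continuous_subtype_val
  have hG : Continuous G.uncurry := by
    have hA1 : Continuous fun q : (ℝ × Metric.sphere (0 : EuclideanSpace ℝ (Fin n)) 1) × ℝ =>
      diagMap a q.1.2 := hA.comp (continuous_snd.comp continuous_fst)
    refine Continuous.mul ?_ (hφc.comp continuous_snd)
    refine (contDiffOn_filteredMean_uncurry hf).continuousOn.comp_continuous
      (f := fun q : (ℝ × Metric.sphere (0 : EuclideanSpace ℝ (Fin n)) 1) × ℝ =>
        (diagMap a q.1.2, √(max (‖x - diagMap a q.1.2‖ ^ 2 - q.1.1 * q.2) (τ / 2)))) ?_ fun q => ?_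
    · exact hA1.prodMk (((((continuous_const.sub hA1).norm.pow 2).sub (by fun_prop)).max
        continuous_const).sqrt)
    · exact ⟨mem_univ _, Real.sqrt_pos.2 (lt_max_of_lt_right (half_pos hτ))⟩
  have hG1 := continuous_parametric_integral_of_continuous (μ := volume) hG
    (isCompact_Icc (a := (-1 : ℝ)) (b := 1))
  have hG2 := continuous_parametric_integral_of_continuous
    (μ := (volume : Measure (EuclideanSpace ℝ (Fin n))).toSphere)
    (f := fun (ε : ℝ) (σ : Metric.sphere (0 : EuclideanSpace ℝ (Fin n)) 1) =>
      ∫ v in Icc (-1 : ℝ) 1, G (ε, σ) v) hG1 isCompact_univ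
  simp only [Measure.restrict_univ] at hG2
  have h0 : (∫ σ : Metric.sphere (0 : EuclideanSpace ℝ (Fin n)) 1,
      (∫ v in Icc (-1 : ℝ) 1, G (0, σ) v)
        ∂(volume : Measure (EuclideanSpace ℝ (Fin n))).toSphere) = backProjection a f x := by
    refine integral_congr_ae (Eventually.of_forall fun σ => ?_)
    have hs : √(max (‖x - diagMap a σ‖ ^ 2 - 0) (τ / 2)) = ‖x - diagMap a σ‖ := by
      rw [max_eq_left (by linarith [hτx σ]), sub_zero, Real.sqrt_sq (norm_nonneg _)]
    simp only [G, zero_mul, hs]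
    rw [integral_const_mul, setIntegral_eq_integral_of_forall_compl_eq_zero, hφ1, mul_one]
    exact fun v hv => image_eq_zero_of_notMem_tsupport fun h => hv (Ioo_subset_Icc_self (hφ h))
  rw [← h0]
  refine (hG2.tendsto 0 |>.mono_left nhdsWithin_le_nhds).congr' ?_
  filter_upwards [Ioo_mem_nhdsGT (half_pos hτ)] with ε hε
  refine integral_congr_ae (Eventually.of_forall fun σ => ?_)
  simp only
  rw [integral_Ioi_mul_mollifier hφ hε.1 (by linarith [hε.2, hτx σ])]
  refine setIntegral_congr_fun measurableSet_Icc fun v hv => ?_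
  have : ε * v ≤ ε * 1 := mul_le_mul_of_nonneg_left hv.2 hε.1.le
  simp only [G]
  rw [max_eq_left (by linarith [hε.2, hτx σ])]

/-! ### The backprojection is a multiple of the potential. -/

section

variable {p : ℕ} {a : Fin (2 * p + 3) → ℝ} {f : EuclideanSpace ℝ (Fin (2 * p + 3)) → ℝ}

/-- Cauchy–Schwarz for `‖y‖² - ‖x‖² = ⟨A(y - x), A⁻¹(y + x)⟩`. For `x` in the open ellipsoid the
factor is strictly below 2, which is the room needed for `ε` in the zonal integral. -/
theorem abs_norm_sq_sub_norm_sq_le {n : ℕ} {a : Fin n → ℝ} (ha : ∀ i, a i ≠ 0)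
    {x y : EuclideanSpace ℝ (Fin n)} (hy : ‖diagMap a⁻¹ y‖ ≤ 1) :
    |‖y‖ ^ 2 - ‖x‖ ^ 2| ≤ (1 + ‖diagMap a⁻¹ x‖) * ‖diagMap a (y - x)‖ := by
  have h1 : ‖y‖ ^ 2 - ‖x‖ ^ 2 = inner ℝ (diagMap a (y - x)) (diagMap a⁻¹ (y + x)) := by
    rw [inner_diagMap_left, diagMap_diagMap_inv ha, inner_sub_left, inner_add_right,
      inner_add_right, real_inner_self_eq_norm_sq, real_inner_self_eq_norm_sq, real_inner_comm]
    ring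
  rw [h1, mul_comm]
  refine (abs_real_inner_le_norm _ _).trans ?_
  gcongr
  rw [map_add]
  exact (norm_add_le _ _).trans (by gcongr)

/-- The constant relating the backprojection to the potential, up to `2 / ω_{n-1}`. -/
noncomputable def zonalConst (p : ℕ) : ℝ :=
  sphereArea (2 * p + 1) * ((-1) ^ p * ((2 * p).factorial : ℝ)) / 2 ^ (2 * p + 1)

theorem integral_sphere_iteratedDeriv_mollifier {φ : ℝ → ℝ} (hφc : ContDiff ℝ ∞ φ)
    (hφ : tsupport φ ⊆ Ioo (-1) 1) (hφ1 : ∫ s, φ s = 1) {ε c : ℝ} (hε : 0 < ε)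
    {u : EuclideanSpace ℝ (Fin (2 * p + 3))} (hu : u ≠ 0) (h : |c| + ε ≤ 2 * ‖u‖) :
    ∫ σ : Metric.sphere (0 : EuclideanSpace ℝ (Fin (2 * p + 3))) 1,
        iteratedDeriv (2 * p) (mollifier φ ε)
          (2 * inner ℝ u (σ : EuclideanSpace ℝ (Fin (2 * p + 3))) - c)
          ∂(volume : Measure (EuclideanSpace ℝ (Fin (2 * p + 3)))).toSphere =
      zonalConst p * (‖u‖ ^ (2 * p + 1))⁻¹ := by
  rw [integral_sphere_iteratedDeriv (contDiff_mollifier hφc) u (tsupport_mollifier_subset hε hφ)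
    h hu, integral_mollifier hε, hφ1, zonalConst, mul_pow, mul_one, div_mul_eq_div_div,
    div_eq_mul_inv _ (‖u‖ ^ (2 * p + 1))]

/-- For fixed `y ≠ x` in the support of `f`, the inner integral equals its limit as soon as `ε ≤ δ
‖A(y - x)‖`. Only domination near `y = x` needs an estimate. -/
theorem tendsto_integral_mul_sphere_mollifier (ha : ∀ i, a i ≠ 0) (hf : ContDiff ℝ ∞ f)
    (hsupp : tsupport f ⊆ closure (solidEllipsoid a))
    {x : EuclideanSpace ℝ (Fin (2 * p + 3))} (hx : x ∈ solidEllipsoid a)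
    {φ : ℝ → ℝ} (hφc : ContDiff ℝ ∞ φ) (hφ : tsupport φ ⊆ Ioo (-1) 1) (hφ1 : ∫ s, φ s = 1) :
    Tendsto (fun ε => ∫ y, f y *
        ∫ σ : Metric.sphere (0 : EuclideanSpace ℝ (Fin (2 * p + 3))) 1,
          iteratedDeriv (2 * p) (mollifier φ ε)
            (2 * inner ℝ (diagMap a (y - x)) (σ : EuclideanSpace ℝ (Fin (2 * p + 3))) -
              (‖y‖ ^ 2 - ‖x‖ ^ 2))
            ∂(volume : Measure (EuclideanSpace ℝ (Fin (2 * p + 3)))).toSphere)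
      (𝓝[>] 0) (𝓝 (zonalConst p * diagPotential a f x)) := by
  have hs : HasCompactSupport f :=
    (isCompact_closure_solidEllipsoid ha).of_isClosed_subset (isClosed_tsupport f) hsupp
  set δ := 1 - ‖diagMap a⁻¹ x‖ with hδ
  have hδp : 0 < δ := sub_pos.2 (mem_solidEllipsoid_iff.1 hx)
  obtain ⟨B, hB⟩ : ∃ B, ∀ s, |iteratedDeriv (2 * p) φ s| ≤ B := by
    have hcs : HasCompactSupport (iteratedDeriv (2 * p) φ) :=
      HasCompactSupport.of_support_subset_isCompact (isCompact_Icc (a := (-1 : ℝ)) (b := 1))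
        fun s hs => by
          by_contra h
          exact hs (iteratedDeriv_eq_zero_of_notMem_tsupport _
            fun h' => h (Ioo_subset_Icc_self (hφ h')))
    exact (continuous_iteratedDeriv_of_contDiff hφc _).bounded_above_of_compact_support hcs
  have hB0 : 0 ≤ B := (abs_nonneg _).trans (hB 0)
  have hne : ∀ y, y ≠ x → diagMap a (y - x) ≠ 0 := by
    intro y hy h
    have := diagMap_inv_diagMap ha (y - x)
    rw [h, map_zero] at this
    exact hy (sub_eq_zero.1 this.symm)
  have hae : ∀ᵐ y : EuclideanSpace ℝ (Fin (2 * p + 3)), y ≠ x := by simp [ae_iff]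
  have hexact : ∀ {ε y}, 0 < ε → y ≠ x → y ∈ tsupport f → ε ≤ δ * ‖diagMap a (y - x)‖ →
      ∫ σ : Metric.sphere (0 : EuclideanSpace ℝ (Fin (2 * p + 3))) 1,
          iteratedDeriv (2 * p) (mollifier φ ε)
            (2 * inner ℝ (diagMap a (y - x)) (σ : EuclideanSpace ℝ (Fin (2 * p + 3))) -
              (‖y‖ ^ 2 - ‖x‖ ^ 2))
            ∂(volume : Measure (EuclideanSpace ℝ (Fin (2 * p + 3)))).toSphere =
        zonalConst p * (‖diagMap a (y - x)‖ ^ (2 * p + 1))⁻¹ := by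
    intro ε y hε hy hyf hle
    refine integral_sphere_iteratedDeriv_mollifier hφc hφ hφ1 hε (hne y hy) ?_
    have := abs_norm_sq_sub_norm_sq_le ha (x := x)
      (norm_diagMap_inv_le_one_of_mem_closure (hsupp hyf))
    rw [hδ] at hle
    linarith
  -- The first term covers the range where the exact value is available, the second the range `ε > δ
  -- ‖A(y - x)‖`.
  let D := |zonalConst p| + B * (δ ^ (2 * p + 1))⁻¹ * sphereArea (2 * p + 2)
  have hKint : Integrable fun y => f y * (‖diagMap a (y - x)‖ ^ (2 * p + 1))⁻¹ := by
    have := (locallyIntegrable_inv_norm_diagMap_pow ha).integrable_smul_left_of_hasCompactSupport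
      (g := fun y => f (x + y)) (hf.continuous.comp (by fun_prop))
      (hs.comp_homeomorph (Homeomorph.addLeft x))
    simpa using this.comp_sub_right x
  rw [diagPotential, ← integral_const_mul]
  refine tendsto_integral_filter_of_dominated_convergence
    (fun y => D * |f y * (‖diagMap a (y - x)‖ ^ (2 * p + 1))⁻¹|) ?_ ?_ (hKint.abs.const_mul D) ?_
  · filter_upwards with ε
    have hψ : Continuous (iteratedDeriv (2 * p) (mollifier φ ε)) :=
      continuous_iteratedDeriv_of_contDiff (contDiff_mollifier hφc) _
    have hA : Continuous fun q : EuclideanSpace ℝ (Fin (2 * p + 3)) ×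
        Metric.sphere (0 : EuclideanSpace ℝ (Fin (2 * p + 3))) 1 => diagMap a (q.1 - x) :=
      (continuous_diagMap a).comp (by fun_prop)
    have hc := continuous_parametric_integral_of_continuous
      (μ := (volume : Measure (EuclideanSpace ℝ (Fin (2 * p + 3)))).toSphere)
      (f := fun (y : EuclideanSpace ℝ (Fin (2 * p + 3)))
        (σ : Metric.sphere (0 : EuclideanSpace ℝ (Fin (2 * p + 3))) 1) =>
          iteratedDeriv (2 * p) (mollifier φ ε)
            (2 * inner ℝ (diagMap a (y - x)) (σ : EuclideanSpace ℝ (Fin (2 * p + 3))) -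
              (‖y‖ ^ 2 - ‖x‖ ^ 2))) (hψ.comp (by fun_prop)) isCompact_univ
    simp only [Measure.restrict_univ] at hc
    exact (hf.continuous.mul hc).aestronglyMeasurable
  · filter_upwards [self_mem_nhdsWithin] with ε (hε : 0 < ε)
    filter_upwards [hae] with y hy
    by_cases hyf : y ∈ tsupport f
    swap
    · simp [image_eq_zero_of_notMem_tsupport hyf]
    have hup := norm_pos_iff.2 (hne y hy)
    rw [norm_mul, abs_mul, Real.norm_eq_abs, mul_left_comm]
    refine mul_le_mul_of_nonneg_left ?_ (abs_nonneg _)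
    rw [abs_of_nonneg (by positivity : 0 ≤ (‖diagMap a (y - x)‖ ^ (2 * p + 1))⁻¹), add_mul]
    by_cases hle : ε ≤ δ * ‖diagMap a (y - x)‖
    · rw [hexact hε hy hyf hle, norm_mul, Real.norm_eq_abs,
        Real.norm_of_nonneg (by positivity : 0 ≤ (‖diagMap a (y - x)‖ ^ (2 * p + 1))⁻¹)]
      have := sphereArea_pos (2 * p + 2)
      exact le_add_of_nonneg_right (by positivity)
    -- Here `ε⁻¹ < (δ ‖A(y - x)‖)⁻¹`. The mollifier's derivative of order `2p` scales like
    -- `ε^(-(2p+1))`, exactly the singularity of the kernel.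
    · refine le_add_of_nonneg_of_le (by positivity) ?_
      refine (norm_integral_le_of_norm_le_const
        (C := (δ * ‖diagMap a (y - x)‖)⁻¹ ^ (2 * p + 1) * B)
        (Eventually.of_forall fun σ => ?_)).trans (le_of_eq ?_)
      · rw [iteratedDeriv_mollifier hφc, norm_mul, norm_pow, norm_inv, Real.norm_of_nonneg hε.le]
        have := hB (ε⁻¹ * (2 * inner ℝ (diagMap a (y - x))
          (σ : EuclideanSpace ℝ (Fin (2 * p + 3))) - (‖y‖ ^ 2 - ‖x‖ ^ 2)))
        rw [Real.norm_eq_abs]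
        have h3 := (not_le.1 hle).le
        gcongr
      · rw [sphereArea, inv_pow, mul_pow, mul_inv]
        ring
  · filter_upwards [hae] with y hy
    by_cases hyf : y ∈ tsupport f
    swap
    · simp [image_eq_zero_of_notMem_tsupport hyf]
    have hup := norm_pos_iff.2 (hne y hy)
    refine tendsto_const_nhds.congr' ?_
    filter_upwards [Ioo_mem_nhdsGT (mul_pos hδp hup)] with ε hε
    rw [hexact hε.1 hy hyf hε.2.le]
    ring

/-- For small `ε` both sides are limits of the same mollified quantity. Smallness means `ε < τ`,
which keeps the test functions away from `r = 0` for all `σ` at once. -/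
theorem backProjection_eq_diagPotential (ha : ∀ i, a i ≠ 0) (hf : ContDiff ℝ ∞ f)
    (hsupp : tsupport f ⊆ closure (solidEllipsoid a))
    {x : EuclideanSpace ℝ (Fin (2 * p + 3))} (hx : x ∈ solidEllipsoid a) :
    backProjection a f x =
      2 / sphereArea (2 * p + 2) * (zonalConst p * diagPotential a f x) := by
  have hs : HasCompactSupport f :=
    (isCompact_closure_solidEllipsoid ha).of_isClosed_subset (isClosed_tsupport f) hsupp
  obtain ⟨φ, hφc, hφ, hφ1⟩ := exists_smooth_bump
  obtain ⟨τ, hτ, hτx⟩ := exists_lt_norm_sub_diagMap_sphere_sq ha hx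
  refine tendsto_nhds_unique
    ((tendsto_integral_filteredMean_mollifier ha hf hx hφc.continuous hφ hφ1).congr' ?_)
    ((tendsto_integral_mul_sphere_mollifier ha hf hsupp hx hφc hφ hφ1).const_mul _)
  filter_upwards [Ioo_mem_nhdsGT hτ] with ε hε
  have hψ : Continuous (iteratedDeriv (2 * p) (mollifier φ ε)) :=
    continuous_iteratedDeriv_of_contDiff (contDiff_mollifier hφc) _
  rw [← integral_sphere_integral_swap a hf.continuous hs hψ x, ← integral_const_mul]
  refine integral_congr_ae (Eventually.of_forall fun σ => ?_)
  simp only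
  rw [← integral_sphericalMean_mul hf.continuous hs hψ]
  refine integral_iterate_radialD_mul
    (u := fun r => r ^ (2 * p + 1) * sphericalMean f (diagMap a σ) r) ?_
    (contDiff_mollifier hφc) (hε.2.trans (hτx σ)) (tsupport_mollifier_subset hε.1 hφ) (2 * p)
  refine ContDiff.contDiffOn ?_
  exact (contDiff_id.pow _).mul
    ((contDiff_sphericalMean_uncurry hf).comp (contDiff_const.prodMk contDiff_id))

theorem partialD_congr_nhds {n : ℕ} {u v : EuclideanSpace ℝ (Fin n) → ℝ}
    {x : EuclideanSpace ℝ (Fin n)} (h : u =ᶠ[𝓝 x] v) (i : Fin n) :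
    partialD i u =ᶠ[𝓝 x] partialD i v := by
  filter_upwards [h.eventuallyEq_nhds] with y hy
  exact hy.lineDeriv_eq

/-- The identity with the potential holds only on the open ellipsoid, so it must be differentiated
as an identity of germs. -/
theorem laplacianDiag_congr_nhds {n : ℕ} (a : Fin n → ℝ) {u v : EuclideanSpace ℝ (Fin n) → ℝ}
    {x : EuclideanSpace ℝ (Fin n)} (h : u =ᶠ[𝓝 x] v) :
    laplacianDiag a u x = laplacianDiag a v x :=
  Finset.sum_congr rfl fun i _ => by
    rw [(partialD_congr_nhds (partialD_congr_nhds h i) i).eq_of_nhds]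

end

/-! ### The reconstruction formula. -/

theorem theorem2 (n : ℕ) (hn : 3 ≤ n) (hodd : Odd n) (a : Fin n → ℝ) (ha : ∀ i, 0 < a i)
    (f : EuclideanSpace ℝ (Fin n) → ℝ) (hf : ContDiff ℝ ∞ f)
    (hsupp : tsupport f ⊆ closure (solidEllipsoid a)) :
    -- the objects in the formula are well defined
    (∀ z, ContDiffOn ℝ ∞ (sphericalMean f z) (Set.Ioi 0)) ∧
    (∀ x ∈ solidEllipsoid a,
      Integrable
        (fun σ : Metric.sphere (0 : EuclideanSpace ℝ (Fin n)) 1 =>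
          filteredMean f (diagMap a σ) ‖x - diagMap a σ‖)
        (volume : Measure (EuclideanSpace ℝ (Fin n))).toSphere) ∧
    ContDiffOn ℝ 2 (backProjection a f) (solidEllipsoid a) ∧
    -- the reconstruction formula
    ∀ x ∈ solidEllipsoid a,
      f x = (Matrix.diagonal a).det / oddConst n * laplacianDiag a (backProjection a f) x := by
  have ha0 : ∀ i, a i ≠ 0 := fun i => (ha i).ne'
  obtain ⟨p, rfl⟩ : ∃ p, n = 2 * p + 3 := by
    obtain ⟨k, hk⟩ := hodd
    exact ⟨k - 1, by omega⟩
  have hs : HasCompactSupport f :=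
    (isCompact_closure_solidEllipsoid ha0).of_isClosed_subset (isClosed_tsupport f) hsupp
  -- The constant is absorbed into the density, so the results on potentials apply directly to `κ *
  -- f`.
  set κ := 2 / sphereArea (2 * p + 2) * zonalConst p with hκ
  have heq : ∀ x ∈ solidEllipsoid a, backProjection a f x =
      diagPotential a (fun y => κ * f y) x := by
    intro x hx
    rw [backProjection_eq_diagPotential ha0 hf hsupp hx, diagPotential, diagPotential, ← mul_assoc,
      ← hκ, ← integral_const_mul]
    simp only [mul_assoc]
  have hκf : ContDiff ℝ ∞ fun y => κ * f y := contDiff_const.mul hf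
  have hκs : HasCompactSupport fun y => κ * f y := hs.mul_left
  refine ⟨fun z => ?_, fun x hx => ?_, ?_, fun x hx => ?_⟩
  · exact ((contDiff_sphericalMean_uncurry hf).comp
      (contDiff_const.prodMk contDiff_id)).contDiffOn
  · exact (continuous_filteredMean_sphere ha0 hf hx).integrable_of_hasCompactSupport
      (HasCompactSupport.of_compactSpace _)
  · exact ((contDiff_infty.1 (contDiff_diagPotential ha0 hκf hκs) 2).contDiffOn).congr heq
  · have h1 : backProjection a f =ᶠ[𝓝 x] diagPotential a fun y => κ * f y := by
      filter_upwards [(isOpen_solidEllipsoid a).mem_nhds hx] with y hy using heq y hy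
    rw [laplacianDiag_congr_nhds a h1, laplacianDiag_diagPotential ha hκf hκs, hκ, zonalConst,
      oddConst]
    have hdet : (Matrix.diagonal a).det ≠ 0 := by
      rw [Matrix.det_diagonal]; exact Finset.prod_ne_zero_iff.2 fun i _ => ha0 i
    have hω1 := (sphereArea_pos (2 * p + 1)).ne'
    have hω2 := (sphereArea_pos (2 * p + 2)).ne'
    have hfac : ((2 * p).factorial : ℝ) ≠ 0 := by positivity
    have e1 : (2 * p + 3 - 1) / 2 = p + 1 := by omega
    have e2 : 2 * p + 3 - 2 = 2 * p + 1 := by omega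
    have e3 : (3 : ℤ) - ((2 * p + 3 : ℕ) : ℤ) = -((2 * p : ℕ) : ℤ) := by push_cast; ring
    -- The Laplacian supplies the factor `-(2p + 1)`: it completes `(2p)!` to `(n - 2)!` and
    -- `(-1)^p` to `(-1)^(p+1)`. The two factors `ω_{n-1}` cancel, and `2 / 2^(2p+1) = 2^(3-n)`.
    rw [e1, e2, e3, zpow_neg, zpow_natCast, Nat.factorial_succ]
    push_cast
    have hp : (2 * (p : ℝ) + 1) ≠ 0 := by positivity
    rw [pow_succ (2 : ℝ), pow_succ (-1 : ℝ) p]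
    field_simp
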